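/- Fix $0<q<\alpha<1$. Let $a:\mathbb R\to\mathbb R$ be Lipschitz and strictly increasing, concave on $\mathbb R_+=[0,\infty)$, with $a(0)=0$ and, for some constant $c$, $a(x)=c+x^q$ for all $x\ge 1$. (For instance, the odd function with $a(x)=(q+q|q-1|)x-\tfrac12 q|q-1|x^2$ on $[0,1]$ and $a(x)=x^q+q+\tfrac12q|q-1|-1$ on $[1,\infty)$.) Let $\nu$ be the probability measure on $\mathbb R_+$ with $\int e^{-\lambda u}\,\nu(du)=e^{-\lambda^\alpha}$ for all $\lambda\ge0$. Let $\mathcal P_1(\mathbb R)$, resp. $\mathcal P_1(\mathbb R_+)$, be the set of probability measures on $\mathbb R$, resp. $\mathbb R_+$, with finite first moment, the latter regarded as a subset of the former, and let $\Pi(\mu,\tilde\mu)$ be the set of couplings of $\mu$ and $\tilde\mu$. Assumptions on the drift $b:\mathbb R\times\mathcal P_1(\mathbb R)\to\mathbb R$. (i) $b(0,\mu)\ge0$ for all $\mu\in\mathcal P_1(\mathbb R_+)$. (ii) $\sup_{x\in\mathbb R_+,\,\mu\in\mathcal P_1(\mathbb R_+)}|b(x,\mu)|<\infty$. (iii) There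 is $C>0$ such that for all $x,\tilde x\in\mathbb R_+$ and $\mu,\tilde\mu\in\mathcal P_1(\mathbb R_+)$, $$|b(x,\mu)-b(\tilde x,\tilde\mu)|\le C\Big(|a(x)-a(\tilde x)|+\inf_{\rho\in\Pi(\mu,\tilde\mu)}\int|a(y)-a(y')|\,\rho(dy,dy')\Big).$$ Assumptions on the jumps and the initial law. $f:\mathbb R\to\mathbb R$ is bounded, Lipschitz and bounded below by a strictly positive constant; $\psi:\mathbb R\to[0,\infty)$ is bounded and Lipschitz; there is $C>0$ with $|f(x)-f(y)|+|\psi(x)-\psi(y)|\le C|a(x)-a(y)|$ for all $x,y\ge0$; $\nu_0$ is a probability measure on $\mathbb R_+$ with finite moment of order $(2\alpha)\vee1$ and $\nu_0(\{0\})=0$. On a probability space let $(\pi^i)_{i\ge1}$ be i.i.d. Poisson random measures on $\mathbb R_+^3$ with intensity $ds\,dz\,\nu(du)$ and let $(X_0^i)_{i\ge1}$ be i.i.d. with law $\nu_0$, the two families being independent. Let $\mathcal F_t$ be the $\sigma$-algebra generated by all $X^i_0$, $i\ge1$, and all $\pi^i([0,s]\times A\times B)$, $s\le t$, $A,B\in\mathcal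 B(\mathbb R_+)$, $i\ge1$. For $N\ge1$, a solution of the $N$-particle system is a family of real-valued processes $(X^{N,i}_t)_{t\ge0}$, $1\le i\le N$, such that almost surely the paths are càdlàg and, for all $t\ge0$ and all $1\le i\le N$, the following integrals exist and $$X^{N,i}_t=X^i_0+\int_0^t b(X^{N,i}_s,\mu^N_s)\,ds+\int_{[0,t]\times\mathbb R_+\times\mathbb R_+}\psi(X^{N,i}_{s-})\mathbf 1_{\{z\le f(X^{N,i}_{s-})\}}\,\pi^i(ds,dz,du)+\frac1{N^{1/\alpha}}\sum_{j\ne i}\int_{[0,t]\times\mathbb R_+\times\mathbb R_+}u\,\mathbf 1_{\{z\le f(X^{N,j}_{s-})\}}\,\pi^j(ds,dz,du),$$ where $\mu^N_s=\frac1N\sum_{i=1}^N\delta_{X^{N,i}_s}$. A strong solution is a solution adapted to $(\mathcal F_t)_{t\ge0}$. Then for every $N\ge1$ there is a strong solution $X^N$ with values in $\mathbb R_+^N$, and every solution is indistinguishable from it. Moreover, for every $T>0$ there is a constant $C_T<\infty$, independent of $N$ and $i$, such that $$\mathbb E\Big(\sup_{t\le T}|a(X^{N,i}_t)|\Big)\le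 C_T\qquad\text{for all }N\ge1,\ 1\le i\le N.$$ -/

import Mathlib

open MeasureTheory ProbabilityTheory Set Filter Topology
open scoped NNReal ENNReal

noncomputable section

namespace StableParticles

/-- The function `a` inducing the distance `|a x - a y|`: vanishing at `0`, concave on `ℝ₊`,
Lipschitz, strictly increasing and equal to `c + x ^ q` for `x ≥ 1`. The explicit function which is
odd, equal to `(q + q|q-1|) x - q|q-1| x² / 2` on `[0, 1]` and to `x ^ q + (q + q|q-1|/2 - 1)` on
`[1, ∞)` has these properties; no second order regularity is required. -/
structure IsDistanceFunction (q : ℝ) (a : ℝ → ℝ) : Prop where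
  zero : a 0 = 0
  concave : ConcaveOn ℝ (Ici 0) a
  lipschitz : ∃ L : ℝ≥0, LipschitzWith L a
  strictMono : StrictMono a
  eq_rpow : ∃ c : ℝ, ∀ x : ℝ, 1 ≤ x → a x = c + x ^ q

/-- The law of a strictly stable random variable `Y ≥ 0` of index `α`, normalised by its Laplace
transform `E (exp (-r Y)) = exp (-r ^ α)`, `r ≥ 0`. -/
structure IsPositiveStableLaw (α : ℝ) (ν : Measure ℝ) : Prop where
  isProbabilityMeasure : IsProbabilityMeasure ν
  nonneg : ν (Iio 0) = 0
  laplace : ∀ r : ℝ, 0 ≤ r → ∫ u, Real.exp (-r * u) ∂ν = Real.exp (-(r ^ α))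

/-- `𝒫₁(ℝ₊)`: probability measures on `ℝ` that are carried by `ℝ₊` and have a finite first
moment. -/
def P1 : Set (Measure ℝ) :=
  {μ | IsProbabilityMeasure μ ∧ μ (Iio 0) = 0 ∧ Integrable (fun x : ℝ => x) μ}

/-- The couplings of `μ` and `μ'`: measures on the product with these marginals. -/
def couplings (μ μ' : Measure ℝ) : Set (Measure (ℝ × ℝ)) :=
  {ρ | ρ.map Prod.fst = μ ∧ ρ.map Prod.snd = μ'}

/-- The Wasserstein distance induced by `a`: the infimum over all couplings `ρ` of
`∫ |a y - a y'| ρ(dy, dy')`. -/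
def wasserstein (a : ℝ → ℝ) (μ μ' : Measure ℝ) : ℝ :=
  sInf ((fun ρ : Measure (ℝ × ℝ) => ∫ p, |a p.1 - a p.2| ∂ρ) '' couplings μ μ')

/-- The assumption on the drift; only the values of `b` on `ℝ₊ × 𝒫₁(ℝ₊)` are constrained. -/
structure DriftAssumption (a : ℝ → ℝ) (b : ℝ → Measure ℝ → ℝ) : Prop where
  nonneg_zero : ∀ μ ∈ P1, 0 ≤ b 0 μ
  bounded : ∃ K : ℝ, ∀ x : ℝ, 0 ≤ x → ∀ μ ∈ P1, |b x μ| ≤ K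
  lipschitz : ∃ C : ℝ, 0 < C ∧ ∀ x x' : ℝ, 0 ≤ x → 0 ≤ x' → ∀ μ ∈ P1, ∀ μ' ∈ P1,
    |b x μ - b x' μ'| ≤ C * (|a x - a x'| + wasserstein a μ μ')

/-- The assumption on the jump rate `f`, the jump height `ψ` and the initial law `ν₀`. -/
structure JumpAssumption (α : ℝ) (a f ψ : ℝ → ℝ) (ν₀ : Measure ℝ) : Prop where
  f_lower : ∃ c : ℝ, 0 < c ∧ ∀ x, c ≤ f x
  f_bounded : ∃ K : ℝ, ∀ x, f x ≤ K
  f_lipschitz : ∃ L : ℝ≥0, LipschitzWith L f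
  psi_nonneg : ∀ x, 0 ≤ ψ x
  psi_bounded : ∃ K : ℝ, ∀ x, ψ x ≤ K
  psi_lipschitz : ∃ L : ℝ≥0, LipschitzWith L ψ
  lipschitz : ∃ C : ℝ, 0 < C ∧ ∀ x y : ℝ, 0 ≤ x → 0 ≤ y →
    |f x - f y| + |ψ x - ψ y| ≤ C * |a x - a y|
  init_isProbabilityMeasure : IsProbabilityMeasure ν₀
  init_nonneg : ν₀ (Iio 0) = 0
  init_zero : ν₀ {0} = 0
  init_moment : Integrable (fun x : ℝ => |x| ^ max (2 * α) 1) ν₀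

/-- `η` is, under `P`, a Poisson random measure with intensity `m`: a random measure with values in
`ℕ ∪ {∞}` such that `η B` is Poisson distributed with parameter `m B` (equal to `∞` if `m B = ∞`)
and such that its values on pairwise disjoint sets are independent. -/
structure IsPoissonRandomMeasure {Ω E : Type*} [MeasurableSpace Ω] [MeasurableSpace E]
    (P : Measure Ω) (η : Ω → Measure E) (m : Measure E) : Prop where
  measurable : Measurable η
  integer_valued : ∀ᵐ ω ∂P, ∀ B, MeasurableSet B → η ω B = ∞ ∨ ∃ n : ℕ, η ω B = n
  law : ∀ B, MeasurableSet B → m B ≠ ∞ →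
    P.map (fun ω => η ω B) = (poissonMeasure (m B).toNNReal).map (fun n : ℕ => (n : ℝ≥0∞))
  law_top : ∀ B, MeasurableSet B → m B = ∞ → ∀ᵐ ω ∂P, η ω B = ∞
  indep : ∀ (n : ℕ) (B : Fin n → Set E), (∀ k, MeasurableSet (B k)) →
    (∀ k l, k ≠ l → Disjoint (B k) (B l)) → iIndepFun (fun k ω => η ω (B k)) P

/-- The intensity `ds dz ν(du)` on `ℝ₊ × ℝ₊ × ℝ₊` (as a measure on `ℝ × ℝ × ℝ`, the law `ν` being
carried by `ℝ₊`). -/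
def intensity (ν : Measure ℝ) : Measure (ℝ × ℝ × ℝ) :=
  (volume.restrict (Ici (0 : ℝ))).prod ((volume.restrict (Ici (0 : ℝ))).prod ν)

/-- The driving noise and the initial positions: `(π i)` is an i.i.d. family of Poisson random
measures with intensity `ds dz ν(du)`, `(X₀ i)` is an i.i.d. family with law `ν₀`, and the two
families are independent. -/
structure IsDrivingNoise {Ω : Type*} [MeasurableSpace Ω] (P : Measure Ω) (ν ν₀ : Measure ℝ)
    (π : ℕ → Ω → Measure (ℝ × ℝ × ℝ)) (X₀ : ℕ → Ω → ℝ) : Prop where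
  poisson : ∀ i, IsPoissonRandomMeasure P (π i) (intensity ν)
  poisson_indep : iIndepFun π P
  init_measurable : ∀ i, Measurable (X₀ i)
  init_law : ∀ i, P.map (X₀ i) = ν₀
  init_indep : iIndepFun X₀ P
  indep : IndepFun (fun ω i => π i ω) (fun ω i => X₀ i ω) P

/-- The canonical filtration `ℱ_t`, generated by all `π i ([0, s] × A × B)`, for `s ≤ t` and Borel
sets `A, B ⊆ ℝ₊`, and by all initial positions (without completion). -/
abbrev canonicalFiltration {Ω : Type*} (π : ℕ → Ω → Measure (ℝ × ℝ × ℝ)) (X₀ : ℕ → Ω → ℝ) (t : ℝ) :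
    MeasurableSpace Ω :=
  (⨆ (i : ℕ) (s : ℝ) (_ : s ∈ Icc 0 t) (A : Set ℝ) (_ : MeasurableSet A ∧ A ⊆ Ici 0)
      (B : Set ℝ) (_ : MeasurableSet B ∧ B ⊆ Ici 0),
      MeasurableSpace.comap (fun ω => π i ω (Icc 0 s ×ˢ A ×ˢ B)) inferInstance) ⊔
    ⨆ i : ℕ, MeasurableSpace.comap (X₀ i) inferInstance

/-- A function on `ℝ₊` that is right-continuous and has finite left limits. -/
def IsCadlag (x : ℝ → ℝ) : Prop :=
  (∀ t, 0 ≤ t → ContinuousWithinAt x (Ici t) t) ∧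
    ∀ t, 0 < t → ∃ l, Tendsto x (𝓝[<] t) (𝓝 l)

/-- The empirical measure `N⁻¹ ∑ i, δ_{x i}`. -/
def empirical {N : ℕ} (x : Fin N → ℝ) : Measure ℝ :=
  (N : ℝ≥0∞)⁻¹ • ∑ i, Measure.dirac (x i)

/-- The domain `[0, t] × ℝ₊ × ℝ₊`. -/
def jumpDomain (t : ℝ) : Set (ℝ × ℝ × ℝ) :=
  Icc 0 t ×ˢ Ici 0 ×ˢ Ici 0

/-- The integrand `ψ(x_{s-}) 1_{z ≤ f(x_{s-})}` at `p = (s, z, u)`. -/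
def ownJump (f ψ x : ℝ → ℝ) (p : ℝ × ℝ × ℝ) : ℝ :=
  if p.2.1 ≤ f (Function.leftLim x p.1) then ψ (Function.leftLim x p.1) else 0

/-- The integrand `u 1_{z ≤ f(x_{s-})}` at `p = (s, z, u)`. -/
def collateralJump (f x : ℝ → ℝ) (p : ℝ × ℝ × ℝ) : ℝ :=
  if p.2.1 ≤ f (Function.leftLim x p.1) then p.2.2 else 0

/-- For one realisation `x₀` of the initial positions and `η` of the Poisson measures, the càdlàg
path `x` of the `N` particles satisfies, for all `t ≥ 0` and all `i`,
`x i t = x₀ i + ∫₀ᵗ b(x i s, μ_s) ds + ∫ ψ(x i s-) 1_{z ≤ f(x i s-)} η i (ds, dz, du)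
  + N^{-1/α} ∑_{j ≠ i} ∫ u 1_{z ≤ f(x j s-)} η j (ds, dz, du)`,
`μ_s` being the empirical measure, where all integrals exist. -/
structure IsSolutionPath (α : ℝ) (b : ℝ → Measure ℝ → ℝ) (f ψ : ℝ → ℝ) {N : ℕ}
    (x₀ : Fin N → ℝ) (η : Fin N → Measure (ℝ × ℝ × ℝ)) (x : Fin N → ℝ → ℝ) : Prop where
  cadlag : ∀ i, IsCadlag (x i)
  integrable_drift : ∀ i t, 0 ≤ t →
    IntervalIntegrable (fun s => b (x i s) (empirical fun j => x j s)) volume 0 t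
  integrable_own : ∀ i t, 0 ≤ t → IntegrableOn (ownJump f ψ (x i)) (jumpDomain t) (η i)
  integrable_collateral : ∀ i t, 0 ≤ t → IntegrableOn (collateralJump f (x i)) (jumpDomain t) (η i)
  equation : ∀ i t, 0 ≤ t →
    x i t = x₀ i + (∫ s in (0 : ℝ)..t, b (x i s) (empirical fun j => x j s))
      + (∫ p in jumpDomain t, ownJump f ψ (x i) p ∂(η i))
      + 1 / (N : ℝ) ^ (1 / α) *
          ∑ j ∈ Finset.univ.erase i, ∫ p in jumpDomain t, collateralJump f (x j) p ∂(η j)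

/-- `X` solves the `N`-particle system driven by `π`, started from `X₀`, almost surely. -/
def IsSolution {Ω : Type*} [MeasurableSpace Ω] (P : Measure Ω) (α : ℝ)
    (b : ℝ → Measure ℝ → ℝ) (f ψ : ℝ → ℝ) (π : ℕ → Ω → Measure (ℝ × ℝ × ℝ)) (X₀ : ℕ → Ω → ℝ)
    {N : ℕ} (X : Fin N → ℝ → Ω → ℝ) : Prop :=
  ∀ᵐ ω ∂P, IsSolutionPath α b f ψ (fun i : Fin N => X₀ i ω) (fun i : Fin N => π i ω)
    (fun i t => X i t ω)

/-- A strong solution is a solution adapted to the canonical filtration of the noise and the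
initial positions. -/
structure IsStrongSolution {Ω : Type*} [MeasurableSpace Ω] (P : Measure Ω) (α : ℝ)
    (b : ℝ → Measure ℝ → ℝ) (f ψ : ℝ → ℝ) (π : ℕ → Ω → Measure (ℝ × ℝ × ℝ)) (X₀ : ℕ → Ω → ℝ)
    {N : ℕ} (X : Fin N → ℝ → Ω → ℝ) : Prop where
  isSolution : IsSolution P α b f ψ π X₀ X
  adapted : ∀ i t, 0 ≤ t → Measurable[canonicalFiltration π X₀ t] (X i t)

end StableParticles

end

/-! The rate `f` is bounded by some `K`, so up to time `T` only the points of the noise with `z ≤ K`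
matter. Their intensity is at most `T * K`; almost surely there are finitely many of them, all at
positive times. For fixed `N` the system is thus, path by path, an ordinary differential equation
interrupted by finitely many jumps.

The drift is Lipschitz on the nonnegative orthant, because `a` is Lipschitz and two empirical
measures can be coupled by matching indices. Composing with `max · 0` extends it to a bounded
Lipschitz map of `ℝ ^ N`, and Picard iteration solves the equation for any prescribed jump term. The
map `nextPath` takes the jumps from the left limits of a given path and solves this equation. Its
value at `t` depends only on the path strictly before the atoms up to `t`, so each application
determines the path up to one more atom, and the iteration becomes stationary. This yields existence
and uniqueness for the truncated equation (`exists_solvesUpTo`, `SolvesUpTo.eq_pathLimit`).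

Positivity links it to the original equation. Since `b 0 μ ≥ 0`, the drift is at least `-Λ x` on the
nonnegative axis; the jumps are nonnegative and the initial values almost surely positive, so every
solution stays above a positive exponential (`pos_of_drift_ge`). Adaptedness holds because the
position at `t` is built from the noise up to `t` alone, by limits that are measurable without
discarding a null set.

For the moment bound, `a` is subadditive, being concave with `a 0 = 0`. Hence `a` of the position is
at most the sum of `a` of the initial value, of the drift bound `M * T`, of the own jumps, and of
every single collateral jump `N ^ (-1/α) * u`. The stable law satisfies `E a (ε U) ≤ C ε ^ α`
because `q < α` (`exists_lintegral_le`). With `ε = N ^ (-1/α)` Campbell's formula gives a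
contribution of order `1 / N` per particle, and the sum over the `N` particles is bounded uniformly
in `N`. -/

noncomputable section

namespace StableParticles

/-! ### Integral equations with bounded Lipschitz drift and an arbitrary measurable input. -/

section Picard

variable {E : Type*} [NormedAddCommGroup E] [NormedSpace ℝ E]

/-- The Picard iterates for the integral equation `u t = j t + ∫₀ᵗ B (u s) ds`. -/
def picard (B : E → E) (j : ℝ → E) : ℕ → ℝ → E
  | 0 => j
  | m + 1 => fun t => j t + ∫ s in Ioc 0 t, B (picard B j m s)

/-- The limit of the Picard iterates. -/
def picardLimit (B : E → E) (j : ℝ → E) (t : ℝ) : E :=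
  limUnder atTop (fun m => picard B j m t)

/-- Causality: up to time `T` the iterates see the input only up to time `T`. -/
lemma picard_congr (B : E → E) {j j' : ℝ → E} {T : ℝ} (h : ∀ t ∈ Icc 0 T, j t = j' t) (m : ℕ) :
    ∀ t ∈ Icc 0 T, picard B j m t = picard B j' m t := by
  induction m with
  | zero => exact h
  | succ m ih =>
    intro t ht
    simp only [picard, h t ht]
    congr 1
    refine setIntegral_congr_fun measurableSet_Ioc fun s hs => ?_
    simp only [ih s ⟨hs.1.le, hs.2.trans ht.2⟩]

lemma picardLimit_congr (B : E → E) {j j' : ℝ → E} {T : ℝ} (h : ∀ t ∈ Icc 0 T, j t = j' t) :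
    ∀ t ∈ Icc 0 T, picardLimit B j t = picardLimit B j' t := by
  intro t ht
  simp only [picardLimit, picard_congr B h _ t ht]

lemma stronglyMeasurable_integral_Ioc {S : Type*} [MeasurableSpace S] {g : S → ℝ → E}
    (hg : StronglyMeasurable (Function.uncurry g)) :
    StronglyMeasurable (fun p : S × ℝ => ∫ s in Ioc 0 p.2, g p.1 s) := by
  have h1 : MeasurableSet {x : (S × ℝ) × ℝ | x.2 ∈ Ioc 0 x.1.2} :=
    (measurableSet_lt measurable_const measurable_snd).inter
      (measurableSet_le measurable_snd (measurable_snd.comp measurable_fst))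
  have h2 : StronglyMeasurable (Function.uncurry fun (p : S × ℝ) (s : ℝ) =>
      (Ioc 0 p.2).indicator (g p.1) s) := by
    have h3 : StronglyMeasurable fun x : (S × ℝ) × ℝ => g x.1.1 x.2 :=
      hg.comp_measurable ((measurable_fst.comp measurable_fst).prodMk measurable_snd)
    exact h3.indicator h1
  have := h2.integral_prod_right (ν := (volume : Measure ℝ))
  simpa only [integral_indicator measurableSet_Ioc] using this

lemma stronglyMeasurable_picard {S : Type*} [MeasurableSpace S] {B : E → E} (hB : Continuous B)
    {j : S → ℝ → E} (hj : StronglyMeasurable (Function.uncurry j)) (m : ℕ) :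
    StronglyMeasurable (fun p : S × ℝ => picard B (j p.1) m p.2) := by
  induction m with
  | zero => exact hj
  | succ m ih =>
    exact hj.add (stronglyMeasurable_integral_Ioc (g := fun ω s => B (picard B (j ω) m s))
      (hB.comp_stronglyMeasurable ih))

lemma stronglyMeasurable_picard' {B : E → E} (hB : Continuous B)
    {j : ℝ → E} (hj : StronglyMeasurable j) (m : ℕ) : StronglyMeasurable (picard B j m) :=
  (stronglyMeasurable_picard (S := Unit) hB (j := fun _ => j)
    (hj.comp_measurable measurable_snd) m).comp_measurable (measurable_const (a := ()) |>.prodMk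
      measurable_id)

variable {B : E → E} {L : ℝ≥0} {K : ℝ}

omit [NormedSpace ℝ E] in
lemma integrableOn_of_bound (hB : LipschitzWith L B) (hK : ∀ x, ‖B x‖ ≤ K) {u : ℝ → E}
    (hu : StronglyMeasurable u) (t : ℝ) : IntegrableOn (fun s => B (u s)) (Ioc 0 t) :=
  Measure.integrableOn_of_bounded (M := K) (by simp)
    (hB.continuous.comp_stronglyMeasurable hu).aestronglyMeasurable (ae_of_all _ fun _ => hK _)

/-- In the norm weighted by `exp (-2 L t)` the integral operator contracts by the factor `1 / 2`,
since `L * exp (2 L s)` has primitive `exp (2 L s) / 2`. This gives convergence on the whole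
half-line at once. -/
lemma norm_integral_sub_le (hB : LipschitzWith L B) (hL : 1 ≤ L) {u v : ℝ → E} {t c : ℝ}
    (hc : 0 ≤ c)
    (hu : IntegrableOn (fun s => B (u s)) (Ioc 0 t))
    (hv : IntegrableOn (fun s => B (v s)) (Ioc 0 t))
    (h : ∀ s ∈ Ioc 0 t, ‖u s - v s‖ ≤ c * Real.exp (2 * L * s)) :
    ‖(∫ s in Ioc 0 t, B (u s)) - ∫ s in Ioc 0 t, B (v s)‖ ≤ c / 2 * Real.exp (2 * L * t) := by
  rcases le_or_gt 0 t with ht | ht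
  swap
  · simp only [Ioc_eq_empty (not_lt.2 ht.le), Measure.restrict_empty, integral_zero_measure,
      sub_self, norm_zero]
    positivity
  have hL0 : (0 : ℝ) < L := by exact_mod_cast zero_lt_one.trans_le hL
  have hder : ∀ s ∈ uIcc 0 t, HasDerivAt (fun s => c / 2 * Real.exp (2 * L * s))
      (L * (c * Real.exp (2 * L * s))) s := by
    intro s _
    have h1 : HasDerivAt (fun s : ℝ => 2 * (L : ℝ) * s) (2 * L) s := by
      simpa using (hasDerivAt_id s).const_mul (2 * (L : ℝ))
    convert! (h1.exp.const_mul (c / 2)) using 1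
    ring
  have hint : IntervalIntegrable (fun s => L * (c * Real.exp (2 * L * s))) volume 0 t :=
    Continuous.intervalIntegrable (by fun_prop) _ _
  have hval := intervalIntegral.integral_eq_sub_of_hasDerivAt hder hint
  rw [intervalIntegral.integral_of_le ht] at hval
  rw [← integral_sub hu hv]
  refine (norm_integral_le_of_norm_le (g := fun s => L * (c * Real.exp (2 * L * s)))
    ((intervalIntegrable_iff_integrableOn_Ioc_of_le ht).1 hint) ?_).trans ?_
  · refine (ae_restrict_iff' measurableSet_Ioc).2 (ae_of_all _ fun s hs => ?_)
    have := hB.dist_le_mul (u s) (v s)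
    rw [dist_eq_norm, dist_eq_norm] at this
    exact this.trans (mul_le_mul_of_nonneg_left (h s hs) hL0.le)
  · rw [hval]
    have : 0 ≤ c / 2 * Real.exp (2 * L * 0) := by positivity
    linarith

lemma norm_integral_Ioc_le (hL : 1 ≤ L) (hK0 : 0 ≤ K) (hK : ∀ x, ‖B x‖ ≤ K) (u : ℝ → E) (t : ℝ) :
    ‖∫ s in Ioc 0 t, B (u s)‖ ≤ K * Real.exp (2 * L * t) := by
  rcases le_or_gt 0 t with ht | ht
  swap
  · simp only [Ioc_eq_empty (not_lt.2 ht.le), Measure.restrict_empty, integral_zero_measure,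
      norm_zero]
    positivity
  have h1 := norm_setIntegral_le_of_norm_le_const (μ := (volume : Measure ℝ)) (s := Ioc 0 t)
    (f := fun s => B (u s)) (C := K) (by simp) (fun s _ => hK _)
  refine h1.trans (mul_le_mul_of_nonneg_left ?_ hK0)
  -- Here `1 ≤ L` matters: it gives `t ≤ 2 L t + 1 ≤ exp (2 L t)`.
  have hL0 : (1 : ℝ) ≤ L := by exact_mod_cast hL
  simp only [measureReal_def, Real.volume_Ioc, sub_zero, ENNReal.toReal_ofReal ht]
  have := Real.add_one_le_exp (2 * L * t)
  nlinarith

lemma norm_picard_succ_sub_le (hB : LipschitzWith L B) (hL : 1 ≤ L) (hK0 : 0 ≤ K)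
    (hK : ∀ x, ‖B x‖ ≤ K) {j : ℝ → E} (hj : StronglyMeasurable j) (m : ℕ) (t : ℝ) :
    ‖picard B j (m + 1) t - picard B j m t‖ ≤ K / 2 ^ m * Real.exp (2 * L * t) := by
  induction m generalizing t with
  | zero => simpa [picard] using norm_integral_Ioc_le hL hK0 hK j t
  | succ m ih =>
    rw [picard, picard, add_sub_add_left_eq_sub]
    refine (norm_integral_sub_le hB hL (c := K / 2 ^ m) (by positivity)
      (integrableOn_of_bound hB hK (stronglyMeasurable_picard' hB.continuous hj _) t)
      (integrableOn_of_bound hB hK (stronglyMeasurable_picard' hB.continuous hj _) t)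
      fun s _ => ih s).trans_eq ?_
    rw [pow_succ, div_div]

variable [CompleteSpace E]

lemma tendsto_picard (hB : LipschitzWith L B) (hL : 1 ≤ L) (hK0 : 0 ≤ K)
    (hK : ∀ x, ‖B x‖ ≤ K) {j : ℝ → E} (hj : StronglyMeasurable j) (t : ℝ) :
    Tendsto (fun m => picard B j m t) atTop (𝓝 (picardLimit B j t)) := by
  have hc : CauchySeq fun m => picard B j m t := by
    refine cauchySeq_of_le_geometric (1 / 2) (K * Real.exp (2 * L * t)) (by norm_num) fun m => ?_
    rw [dist_comm, dist_eq_norm]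
    refine (norm_picard_succ_sub_le hB hL hK0 hK hj m t).trans_eq ?_
    rw [one_div, inv_pow]; ring
  exact (cauchySeq_tendsto_of_complete hc).choose_spec |> fun h => by
    rw [picardLimit, h.limUnder_eq]; exact h

lemma stronglyMeasurable_picardLimit {S : Type*} [MeasurableSpace S] (hB : LipschitzWith L B)
    (hL : 1 ≤ L) (hK0 : 0 ≤ K) (hK : ∀ x, ‖B x‖ ≤ K) {j : S → ℝ → E}
    (hj : StronglyMeasurable (Function.uncurry j)) :
    StronglyMeasurable (fun p : S × ℝ => picardLimit B (j p.1) p.2) :=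
  stronglyMeasurable_of_tendsto atTop
    (fun m => stronglyMeasurable_picard hB.continuous hj m)
    (tendsto_pi_nhds.2 fun p => tendsto_picard hB hL hK0 hK
      (hj.comp_measurable (measurable_const.prodMk measurable_id)) p.2)

lemma stronglyMeasurable_picardLimit' (hB : LipschitzWith L B)
    (hL : 1 ≤ L) (hK0 : 0 ≤ K) (hK : ∀ x, ‖B x‖ ≤ K) {j : ℝ → E}
    (hj : StronglyMeasurable j) : StronglyMeasurable (picardLimit B j) :=
  stronglyMeasurable_of_tendsto atTop (fun m => stronglyMeasurable_picard' hB.continuous hj m)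
    (tendsto_pi_nhds.2 fun t => tendsto_picard hB hL hK0 hK hj t)

/-- The Picard limit solves the integral equation. -/
lemma picardLimit_eq (hB : LipschitzWith L B) (hL : 1 ≤ L) (hK0 : 0 ≤ K)
    (hK : ∀ x, ‖B x‖ ≤ K) {j : ℝ → E} (hj : StronglyMeasurable j) (t : ℝ) :
    picardLimit B j t = j t + ∫ s in Ioc 0 t, B (picardLimit B j s) := by
  have h1 := (tendsto_picard hB hL hK0 hK hj t).comp (tendsto_add_atTop_nat 1)
  refine tendsto_nhds_unique h1 ?_
  refine tendsto_const_nhds.add ?_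
  refine tendsto_integral_of_dominated_convergence (fun _ => K) (fun m => ?_) ?_ (fun m => ?_) ?_
  · exact (integrableOn_of_bound hB hK (stronglyMeasurable_picard' hB.continuous hj m)
      t).aestronglyMeasurable
  · exact integrableOn_const (by simp)
  · exact ae_of_all _ fun _ => hK _
  · exact ae_of_all _ fun s => (hB.continuous.tendsto _).comp (tendsto_picard hB hL hK0 hK hj s)

/-- Solutions of the integral equation are unique. -/
lemma eq_picardLimit (hB : LipschitzWith L B) (hL : 1 ≤ L) (hK0 : 0 ≤ K)
    (hK : ∀ x, ‖B x‖ ≤ K) {j u : ℝ → E} (hj : StronglyMeasurable j) {T : ℝ}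
    (hu : ∀ t ∈ Icc 0 T, u t = j t + ∫ s in Ioc 0 t, B (u s))
    (hi : IntegrableOn (fun s => B (u s)) (Ioc 0 T)) :
    ∀ t ∈ Icc 0 T, u t = picardLimit B j t := by
  -- The bound on `B` alone starts the induction, so no a priori estimate of `u` is needed.
  have key : ∀ m : ℕ, ∀ t ∈ Icc 0 T,
      ‖u t - picard B j m t‖ ≤ K / 2 ^ m * Real.exp (2 * L * t) := by
    intro m
    induction m with
    | zero =>
      intro t ht
      rw [hu t ht, picard, add_sub_cancel_left]
      simpa using norm_integral_Ioc_le hL hK0 hK u t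
    | succ m ih =>
      intro t ht
      rw [hu t ht, picard, add_sub_add_left_eq_sub]
      refine (norm_integral_sub_le hB hL (c := K / 2 ^ m) (by positivity)
        (hi.mono_set (Ioc_subset_Ioc_right ht.2))
        (integrableOn_of_bound hB hK (stronglyMeasurable_picard' hB.continuous hj _) t)
        fun s hs => ih s ⟨hs.1.le, hs.2.trans ht.2⟩).trans_eq ?_
      rw [pow_succ, div_div]
  intro t ht
  refine tendsto_nhds_unique ?_ (tendsto_picard hB hL hK0 hK hj t)
  rw [tendsto_iff_norm_sub_tendsto_zero]
  refine squeeze_zero (g := fun m : ℕ => K / 2 ^ m * Real.exp (2 * L * t))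
    (fun _ => norm_nonneg _) (fun m => by rw [norm_sub_rev]; exact key m t ht) ?_
  have : Tendsto (fun m : ℕ => K * Real.exp (2 * L * t) * (1 / 2 : ℝ) ^ m) atTop (𝓝 0) := by
    simpa using (tendsto_pow_atTop_nhds_zero_of_lt_one (by norm_num : (0 : ℝ) ≤ 1 / 2)
      (by norm_num)).const_mul (K * Real.exp (2 * L * t))
  refine this.congr fun m => ?_
  rw [one_div, inv_pow]; ring

end Picard

/-! ### The drift: Lipschitz extension to all configurations, and its lower bound. -/

section Drift

lemma isProbabilityMeasure_empirical {N : ℕ} (hN : 1 ≤ N) (x : Fin N → ℝ) :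
    IsProbabilityMeasure (empirical x) := by
  constructor
  simp only [empirical, Measure.smul_apply, Measure.coe_finsetSum, Finset.sum_apply,
    measure_univ, Finset.sum_const, Finset.card_univ, Fintype.card_fin, smul_eq_mul,
    nsmul_eq_mul, mul_one]
  exact ENNReal.inv_mul_cancel (by simpa using Nat.one_le_iff_ne_zero.1 hN) (by simp)

lemma empirical_mem_P1 {N : ℕ} (hN : 1 ≤ N) {x : Fin N → ℝ} (hx : ∀ i, 0 ≤ x i) :
    empirical x ∈ P1 := by
  refine ⟨isProbabilityMeasure_empirical hN x, ?_, ?_⟩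
  · simp [empirical, hx]
  · exact (integrable_finsetSum_measure.2 fun i _ => integrable_dirac (by simp)).smul_measure
      (by simpa using Nat.one_le_iff_ne_zero.1 hN)

/-- The coupling that pairs the `i`-th atoms of the two measures is a competitor in the infimum. -/
lemma wasserstein_empirical_le {N : ℕ} (a : ℝ → ℝ) (x y : Fin N → ℝ) :
    wasserstein a (empirical x) (empirical y) ≤ (N : ℝ)⁻¹ * ∑ i, |a (x i) - a (y i)| := by
  let ρ : Measure (ℝ × ℝ) := (N : ℝ≥0∞)⁻¹ • ∑ i, Measure.dirac (x i, y i)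
  have hρ : ρ ∈ couplings (empirical x) (empirical y) := by
    constructor
    · ext A hA
      simp [ρ, empirical, Measure.map_apply measurable_fst hA, measurable_fst hA, hA]
      rfl
    · ext A hA
      simp [ρ, empirical, Measure.map_apply measurable_snd hA, measurable_snd hA, hA]
      rfl
  refine (csInf_le (⟨0, ?_⟩ : BddBelow _) (mem_image_of_mem _ hρ)).trans_eq ?_
  · rintro _ ⟨ρ, -, rfl⟩
    exact integral_nonneg fun _ => abs_nonneg _
  · simp only [ρ]
    rw [integral_smul_measure, integral_finsetSum_measure
      fun i _ => integrable_dirac (by simp)]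
    simp

/-- The drift of the particle system, extended to all of `ℝ ^ N` by truncation. -/
def truncatedDrift (b : ℝ → Measure ℝ → ℝ) {N : ℕ} (x : Fin N → ℝ) (i : Fin N) : ℝ :=
  b (max (x i) 0) (empirical fun j => max (x j) 0)

variable {q : ℝ} {a : ℝ → ℝ} {b : ℝ → Measure ℝ → ℝ}

lemma truncatedDrift_of_nonneg {N : ℕ} {x : Fin N → ℝ} (hx : ∀ i, 0 ≤ x i) (i : Fin N) :
    truncatedDrift b x i = b (x i) (empirical x) := by
  simp [truncatedDrift, hx]

lemma exists_lipschitz_truncatedDrift (ha : IsDistanceFunction q a) (hb : DriftAssumption a b)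
    {N : ℕ} (hN : 1 ≤ N) :
    ∃ L : ℝ≥0, 1 ≤ L ∧ LipschitzWith L (truncatedDrift b (N := N)) := by
  obtain ⟨C, hC, hbC⟩ := hb.lipschitz
  obtain ⟨L, hL⟩ := ha.lipschitz
  -- One `L` comes from the position and one from the empirical measure; the summand `1` provides
  -- the bound `1 ≤ L` that the Picard estimates require.
  refine ⟨1 + C.toNNReal * (L + L), le_self_add, LipschitzWith.of_dist_le_mul fun x y => ?_⟩
  have hxy : ∀ i, |a (max (x i) 0) - a (max (y i) 0)| ≤ L * dist x y := by
    intro i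
    have h1 := hL.dist_le_mul (max (x i) 0) (max (y i) 0)
    rw [Real.dist_eq] at h1
    refine h1.trans (mul_le_mul_of_nonneg_left ?_ L.2)
    exact (abs_max_sub_max_le_abs (x i) (y i) 0).trans (dist_le_pi_dist x y i)
  refine (dist_pi_le_iff (by positivity)).2 fun i => ?_
  rw [Real.dist_eq]
  refine (hbC _ _ (le_max_right _ _) (le_max_right _ _) _ (empirical_mem_P1 hN fun i =>
    le_max_right _ _) _ (empirical_mem_P1 hN fun i => le_max_right _ _)).trans ?_
  have hN0 : (0 : ℝ) < N := by exact_mod_cast hN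
  have h2 : wasserstein a (empirical fun j => max (x j) 0) (empirical fun j => max (y j) 0)
      ≤ L * dist x y := by
    refine (wasserstein_empirical_le a _ _).trans ?_
    have h3 := Finset.sum_le_sum fun i (_ : i ∈ Finset.univ) => hxy i
    rw [Finset.sum_const, Finset.card_univ, Fintype.card_fin, nsmul_eq_mul] at h3
    calc _ ≤ (N : ℝ)⁻¹ * (N * (L * dist x y)) := by gcongr
      _ = _ := by field_simp
  push_cast
  rw [Real.coe_toNNReal _ hC.le]
  have h4 := mul_le_mul_of_nonneg_left (add_le_add (hxy i) h2) hC.le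
  have h5 : 0 ≤ dist x y := dist_nonneg
  linarith

lemma exists_bound_drift (hb : DriftAssumption a b) :
    ∃ K : ℝ, 0 ≤ K ∧ ∀ x : ℝ, 0 ≤ x → ∀ μ ∈ P1, |b x μ| ≤ K := by
  obtain ⟨K, hK⟩ := hb.bounded
  exact ⟨max K 0, le_max_right _ _, fun x hx μ hμ => (hK x hx μ hμ).trans (le_max_left _ _)⟩

lemma norm_truncatedDrift_le {K : ℝ} (hK0 : 0 ≤ K)
    (hK : ∀ x : ℝ, 0 ≤ x → ∀ μ ∈ P1, |b x μ| ≤ K) {N : ℕ} (hN : 1 ≤ N) (x : Fin N → ℝ) :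
    ‖truncatedDrift b x‖ ≤ K :=
  (pi_norm_le_iff_of_nonneg hK0).2 fun _ => hK _ (le_max_right _ _) _
    (empirical_mem_P1 hN fun _ => le_max_right _ _)

lemma wasserstein_self_le (a : ℝ → ℝ) {μ : Measure ℝ} : wasserstein a μ μ ≤ 0 := by
  have h1 : Measurable fun x : ℝ => (x, x) := measurable_id.prodMk measurable_id
  have h : μ.map (fun x => (x, x)) ∈ couplings μ μ := by
    constructor
    · rw [Measure.map_map measurable_fst h1]
      exact Measure.map_id
    · rw [Measure.map_map measurable_snd h1]
      exact Measure.map_id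
  refine (csInf_le (⟨0, ?_⟩ : BddBelow _) (mem_image_of_mem _ h)).trans_eq ?_
  · rintro _ ⟨ρ, -, rfl⟩
    exact integral_nonneg fun _ => abs_nonneg _
  · refine integral_eq_zero_of_ae ?_
    have h2 : MeasurableSet {p : ℝ × ℝ | p.1 = p.2} :=
      measurableSet_eq_fun measurable_fst measurable_snd
    have h3 : ∀ᵐ p ∂(μ.map fun x => (x, x)), p.1 = p.2 :=
      (ae_map_iff h1.aemeasurable h2).2 (ae_of_all _ fun _ => rfl)
    filter_upwards [h3] with p hp
    simp [hp]

/-- At a nonnegative point `x` the drift is at least `-Λ x`. -/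
lemma exists_drift_ge (ha : IsDistanceFunction q a) (hb : DriftAssumption a b) :
    ∃ Λ : ℝ, 0 ≤ Λ ∧ ∀ x : ℝ, 0 ≤ x → ∀ μ ∈ P1, -(Λ * x) ≤ b x μ := by
  obtain ⟨C, hC, hbC⟩ := hb.lipschitz
  obtain ⟨L, hL⟩ := ha.lipschitz
  refine ⟨C * L, by positivity, fun x hx μ hμ => ?_⟩
  have h1 := hbC x 0 hx le_rfl μ hμ μ hμ
  have h2 := hL.dist_le_mul x 0
  rw [Real.dist_eq, Real.dist_eq, sub_zero, abs_of_nonneg hx] at h2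
  have h3 := hb.nonneg_zero μ hμ
  have h4 := wasserstein_self_le a (μ := μ)
  have h5 := neg_abs_le (b x μ - b 0 μ)
  have h6 := mul_le_mul_of_nonneg_left (add_le_add h2 h4) hC.le
  nlinarith

end Drift

/-! ### Comparison with a decaying exponential. -/

section Positivity

/-- A path which stays above the integral of a rate `β ≥ -Λ x` stays above an exponential. -/
lemma exp_le_of_drift_ge {x β : ℝ → ℝ} {Λ K t : ℝ} (hΛ : 0 ≤ Λ) (ht : 0 ≤ t)
    (hβ : IntervalIntegrable β volume 0 t)
    (hinc : ∀ s r, 0 ≤ s → s ≤ r → r ≤ t → ∫ u in s..r, β u ≤ x r - x s)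
    (hlow : ∀ s ∈ Ico 0 t, -(Λ * x s) ≤ β s) (hK : ∀ s ∈ Ico 0 t, -K ≤ β s) :
    x 0 * Real.exp (-(Λ * t)) ≤ x t := by
  set φ : ℝ → ℝ := fun s => x 0 * Real.exp (-(Λ * s)) with hφ
  have hφc : Continuous φ := by fun_prop
  by_contra! hlt
  -- Let `σ` be the last time, as a supremum, at which `x` is above `φ`. After it `x < φ`, hence `β
  -- ≥ -Λ x ≥ -Λ φ = φ'`.
  set A : Set ℝ := {s ∈ Icc 0 t | φ s ≤ x s} with hA
  have h0A : (0 : ℝ) ∈ A := ⟨⟨le_rfl, ht⟩, by simp [hφ]⟩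
  have hAb : BddAbove A := ⟨t, fun s hs => hs.1.2⟩
  set σ := sSup A with hσ
  have hσ0 : 0 ≤ σ := le_csSup hAb h0A
  have hσt : σ ≤ t := csSup_le ⟨0, h0A⟩ fun s hs => hs.1.2
  have hgt : ∀ s ∈ Ioc σ t, x s < φ s := fun s hs => by
    by_contra! h
    exact (not_le.2 hs.1) (le_csSup hAb ⟨⟨hσ0.trans hs.1.le, hs.2⟩, h⟩)
  have hder : ∀ s ∈ uIcc σ t, HasDerivAt φ (-(Λ * φ s)) s := by
    intro s _
    have h1 : HasDerivAt (fun s : ℝ => -(Λ * s)) (-Λ) s := by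
      simpa using ((hasDerivAt_id s).const_mul Λ).fun_neg
    convert! (h1.exp.const_mul (x 0)) using 1
    simp only [hφ]; ring
  have hint : IntervalIntegrable (fun s => -(Λ * φ s)) volume σ t :=
    Continuous.intervalIntegrable (by fun_prop) _ _
  have hval := intervalIntegral.integral_eq_sub_of_hasDerivAt hder hint
  have hβi : ∀ s r, 0 ≤ s → s ≤ r → r ≤ t → IntervalIntegrable β volume s r := fun s r h0 h1 h2 =>
    hβ.mono_set (by rw [uIcc_of_le h1, uIcc_of_le ht]; exact Icc_subset_Icc h0 h2)
  have hmain : φ t - φ σ ≤ ∫ u in σ..t, β u := by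
    rw [← hval]
    refine intervalIntegral.integral_mono_on_of_le_Ioo hσt hint (hβi _ _ hσ0 hσt le_rfl)
      fun s hs => ?_
    have h1 := hlow s ⟨hσ0.trans hs.1.le, hs.2⟩
    have h2 := hgt s ⟨hs.1, hs.2.le⟩
    nlinarith
  -- The path may be discontinuous, so the supremum need not be attained. The comparison starts from
  -- some `s` in `A` close to `σ`; continuity of `φ` and the bound on `β` make the loss on `[s, σ]`
  -- at most `ε`.
  have hε : ∀ ε > 0, φ t - ε ≤ x t := by
    intro ε hε
    have hcont : Tendsto (fun s => φ s - max K 0 * (σ - s)) (𝓝 σ) (𝓝 (φ σ)) := by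
      have : Continuous fun s => φ s - max K 0 * (σ - s) := by fun_prop
      simpa using this.tendsto σ
    have hev := hcont.eventually (lt_mem_nhds (show φ σ - ε < φ σ by linarith))
    obtain ⟨δ, hδ, hball⟩ := Metric.eventually_nhds_iff.1 hev
    obtain ⟨s, hsA, hs⟩ := exists_lt_of_lt_csSup ⟨0, h0A⟩ (show σ - δ < sSup A by
      rw [← hσ]; linarith)
    have hsσ : s ≤ σ := le_csSup hAb hsA
    have h3 := @hball s (by rw [Real.dist_eq, abs_lt]; constructor <;> linarith)
    have h4 := hinc s t hsA.1.1 hsA.1.2 le_rfl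
    rw [← intervalIntegral.integral_add_adjacent_intervals (hβi s σ hsA.1.1 hsσ hσt)
      (hβi σ t hσ0 hσt le_rfl)] at h4
    have h5 : -(max K 0 * (σ - s)) ≤ ∫ u in s..σ, β u := by
      have h6 : ∫ u in s..σ, (-(max K 0) : ℝ) ≤ ∫ u in s..σ, β u := by
        refine intervalIntegral.integral_mono_on_of_le_Ioo hsσ (by simp)
          (hβi s σ hsA.1.1 hsσ hσt) fun u hu => ?_
        have := hK u ⟨hsA.1.1.trans hu.1.le, hu.2.trans_le hσt⟩
        have h7 := le_max_left K 0
        linarith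
      rw [intervalIntegral.integral_const, smul_eq_mul] at h6
      linarith
    have h8 := hsA.2
    linarith
  have := hε ((φ t - x t) / 2) (by linarith)
  linarith

/-- Paths started from positive points, with nonnegative jumps and a drift which is at least
`-Λ x` as long as all of them are nonnegative, stay positive. -/
lemma pos_of_drift_ge {ι : Type*} [Finite ι] {x β : ι → ℝ → ℝ} {Λ K : ℝ} (hΛ : 0 ≤ Λ)
    (hx0 : ∀ i, 0 < x i 0)
    (hc : ∀ i t, 0 ≤ t → ContinuousWithinAt (x i) (Ici t) t)
    (hβ : ∀ i t, 0 ≤ t → IntervalIntegrable (β i) volume 0 t)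
    (hinc : ∀ i s r, 0 ≤ s → s ≤ r → ∫ u in s..r, β i u ≤ x i r - x i s)
    (hlow : ∀ s, 0 ≤ s → (∀ i, 0 ≤ x i s) → ∀ i, -(Λ * x i s) ≤ β i s ∧ -K ≤ β i s) :
    ∀ i t, 0 ≤ t → 0 < x i t := by
  have hstep : ∀ t, 0 ≤ t → (∀ s ∈ Ico 0 t, ∀ i, 0 ≤ x i s) → ∀ i, 0 < x i t := by
    intro t ht h i
    refine lt_of_lt_of_le (mul_pos (hx0 i) (Real.exp_pos _)) (exp_le_of_drift_ge hΛ ht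
      (hβ i t ht) (fun s r h0 h1 _ => hinc i s r h0 h1) (K := K)
      (fun s hs => (hlow s hs.1 (h s hs) i).1) (fun s hs => (hlow s hs.1 (h s hs) i).2))
  have hall : ∀ s, 0 ≤ s → ∀ i, 0 ≤ x i s := by
    by_contra! hcon
    obtain ⟨s₀, hs₀, i₀, hneg⟩ := hcon
    set A : Set ℝ := {s | 0 ≤ s ∧ ∃ i, x i s < 0} with hA
    have hAne : A.Nonempty := ⟨s₀, hs₀, i₀, hneg⟩
    have hAb : BddBelow A := ⟨0, fun s hs => hs.1⟩
    set τ := sInf A with hτ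
    have hτ0 : 0 ≤ τ := le_csInf hAne fun s hs => hs.1
    have hbefore : ∀ s ∈ Ico 0 τ, ∀ i, 0 ≤ x i s := fun s hs i => by
      by_contra! h
      exact (not_le.2 hs.2) (csInf_le hAb ⟨hs.1, i, h⟩)
    -- Nonnegativity strictly before `τ` already gives strict positivity at `τ`; right-continuity
    -- carries it beyond `τ`, against the choice of `τ` as an infimum.
    have hpos := hstep τ hτ0 hbefore
    have hev : ∀ᶠ s in 𝓝[≥] τ, ∀ i, 0 < x i s :=
      eventually_all.2 fun i => (hc i τ hτ0).eventually (lt_mem_nhds (hpos i))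
    obtain ⟨u, hu, hsub⟩ := (mem_nhdsGE_iff_exists_Ico_subset).1 hev
    obtain ⟨s, ⟨hs0, i, hi⟩, hsu⟩ := exists_lt_of_csInf_lt hAne (show sInf A < u from hu)
    exact absurd (hsub ⟨csInf_le hAb ⟨hs0, i, hi⟩, hsu⟩ i) (not_lt.2 hi.le)
  exact fun i t ht => hstep t ht (fun s hs => hall s hs.1) i

end Positivity

/-! ### Integer-valued finite measures as sums of Dirac masses. -/

section Atoms

/-- A finite measure with integer values is a finite sum of Dirac masses. -/
lemma exists_eq_sum_dirac {X : Type*} [PseudoMetricSpace X] [T0Space X] [SecondCountableTopology X]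
    [MeasurableSpace X] [BorelSpace X] (κ : Measure X) [IsFiniteMeasure κ]
    (h : ∀ B, MeasurableSet B → κ B = ∞ ∨ ∃ n : ℕ, κ B = n) :
    ∃ (n : ℕ) (p : Fin n → X), κ = ∑ k, Measure.dirac (p k) := by
  have hint : ∀ B, MeasurableSet B → ∃ n : ℕ, κ B = n := fun B hB =>
    (h B hB).resolve_left (measure_ne_top κ B)
  obtain ⟨n, hn⟩ := hint univ .univ
  clear h
  induction n generalizing κ with
  | zero => exact ⟨0, Fin.elim0, by simpa using hn⟩
  | succ n ih =>
    -- At a point of the support every ball has positive integer mass, hence mass at least `1`.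
    -- Shrinking the balls yields an atom; one unit of its mass is split off, which lowers the total
    -- mass by one.
    obtain ⟨x, -, hx⟩ := exists_mem_forall_mem_nhdsWithin_pos_measure (μ := κ) (s := univ)
      (by rw [hn]; simp)
    rw [nhdsWithin_univ] at hx
    have hball : ∀ k : ℕ, 1 ≤ κ (Metric.closedBall x (1 / ((k : ℝ) + 1))) := by
      intro k
      have h1 := hx _ (Metric.closedBall_mem_nhds x (ε := 1 / ((k : ℝ) + 1)) (by positivity))
      obtain ⟨m, hm⟩ := hint _ (Metric.isClosed_closedBall (x := x)
        (ε := 1 / ((k : ℝ) + 1))).measurableSet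
      rw [hm] at h1 ⊢
      exact_mod_cast Nat.one_le_iff_ne_zero.2 (by rintro rfl; simp at h1)
    have hsing : ⋂ k : ℕ, Metric.closedBall x (1 / ((k : ℝ) + 1)) = {x} := by
      ext y
      simp only [mem_iInter, Metric.mem_closedBall, mem_singleton_iff]
      refine ⟨fun hy => ?_, fun hy k => by rw [hy, dist_self]; positivity⟩
      have : dist y x ≤ 0 := ge_of_tendsto' tendsto_one_div_add_atTop_nhds_zero_nat hy
      exact (Metric.inseparable_iff.2 (le_antisymm this dist_nonneg)).eq
    have hlim := tendsto_measure_iInter_atTop (μ := κ)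
      (s := fun k : ℕ => Metric.closedBall x (1 / ((k : ℝ) + 1)))
      (fun k => Metric.isClosed_closedBall.measurableSet.nullMeasurableSet)
      (fun k l hkl => Metric.closedBall_subset_closedBall (by gcongr))
      ⟨0, measure_ne_top _ _⟩
    rw [hsing] at hlim
    have hx1 : 1 ≤ κ {x} := ge_of_tendsto' hlim hball
    obtain ⟨m, hm⟩ := hint {x} (measurableSet_singleton x)
    obtain ⟨m, rfl⟩ : ∃ m', m = m' + 1 := by
      refine Nat.exists_eq_succ_of_ne_zero ?_
      rintro rfl
      rw [hm] at hx1
      simp at hx1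
    set κ' : Measure X := m • Measure.dirac x + κ.restrict {x}ᶜ with hκ'
    have hdec : κ = Measure.dirac x + κ' := by
      have h0 := Measure.restrict_add_restrict_compl (μ := κ) (measurableSet_singleton x)
      rw [Measure.restrict_singleton, hm] at h0
      rw [hκ', ← add_assoc, ← succ_nsmul']
      conv_lhs => rw [← h0]
      congr 1
      ext B hB
      simp
    have hfin : IsFiniteMeasure κ' := by
      refine ⟨lt_of_le_of_lt ?_ (measure_lt_top κ univ)⟩
      conv_rhs => rw [hdec]
      exact le_add_self (a := κ' univ) (b := Measure.dirac x univ)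
    have hint' : ∀ B, MeasurableSet B → ∃ n : ℕ, κ' B = n := by
      intro B hB
      obtain ⟨k, hk⟩ := hint (B ∩ {x}ᶜ) (hB.inter (measurableSet_singleton x).compl)
      by_cases hxB : x ∈ B
      · exact ⟨m + k, by simp [hκ', hB, hxB, Measure.restrict_apply hB, hk]⟩
      · exact ⟨k, by simp [hκ', hB, hxB, Measure.restrict_apply hB, hk]⟩
    have hn' : κ' univ = n := by
      have h1 : κ univ = Measure.dirac x univ + κ' univ := by
        conv_lhs => rw [hdec]
        rfl
      rw [hn, measure_univ, Nat.cast_succ, add_comm] at h1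
      exact ((ENNReal.add_right_inj ENNReal.one_ne_top).1 h1).symm
    obtain ⟨p, hp⟩ := ih κ' hint' hn'
    obtain ⟨p', hp'⟩ := hp
    exact ⟨p + 1, Fin.cons x p', by rw [Fin.sum_univ_succ]; simpa [← hp'] using hdec⟩

variable {X : Type*} [MeasurableSpace X] [MeasurableSingletonClass X]

lemma ae_sum_dirac_iff {n : ℕ} {p : Fin n → X} {Q : X → Prop} :
    (∀ᵐ x ∂(∑ k, Measure.dirac (p k)), Q x) ↔ ∀ k, Q (p k) := by
  rw [ae_iff, Measure.coe_finsetSum, Finset.sum_apply, Finset.sum_eq_zero_iff]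
  simp only [Finset.mem_univ, true_implies, ← ae_iff, ae_dirac_eq, eventually_pure]

lemma integrable_sum_dirac {n : ℕ} (p : Fin n → X) (g : X → ℝ) :
    Integrable g (∑ k, Measure.dirac (p k)) :=
  integrable_finsetSum_measure.2 fun _ _ => integrable_dirac (by simp)

lemma integral_sum_dirac' {n : ℕ} (p : Fin n → X) (g : X → ℝ) :
    ∫ x, g x ∂(∑ k, Measure.dirac (p k)) = ∑ k, g (p k) := by
  rw [integral_finsetSum_measure fun i _ => integrable_dirac (by simp)]
  simp

lemma setIntegral_sum_dirac {n : ℕ} (p : Fin n → X) (g : X → ℝ) {A : Set X}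
    (hA : MeasurableSet A) :
    ∫ x in A, g x ∂(∑ k, Measure.dirac (p k)) = ∑ k, A.indicator g (p k) := by
  rw [← integral_indicator hA, integral_sum_dirac']

end Atoms

/-! ### The pathwise construction for finitely many atoms. -/

section Construction

/-- The left limit of `x` at `r`, computed along the sequence `r - 1 / (n + 1)`. -/
def leftValue {N : ℕ} (x : ℝ → Fin N → ℝ) (r : ℝ) (i : Fin N) : ℝ :=
  limsup (fun n : ℕ => x (r - 1 / ((n : ℝ) + 1)) i) atTop

/-- The jump at `p = (s, z, u)` of a particle located at `y`. -/
def ownJumpAt (f ψ : ℝ → ℝ) (y : ℝ) (p : ℝ × ℝ × ℝ) : ℝ :=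
  if p.2.1 ≤ f y then ψ y else 0

/-- The jump at `p = (s, z, u)` that a particle located at `y` inflicts on the others. -/
def collateralJumpAt (f : ℝ → ℝ) (y : ℝ) (p : ℝ × ℝ × ℝ) : ℝ :=
  if p.2.1 ≤ f y then p.2.2 else 0

/-- The sum of all the jumps of particle `i` up to time `t`, if `y s` are the positions
immediately before time `s`. -/
def jumpTerm (α : ℝ) (f ψ : ℝ → ℝ) {N : ℕ} (κ : Fin N → Measure (ℝ × ℝ × ℝ))
    (y : ℝ → Fin N → ℝ) (t : ℝ) (i : Fin N) : ℝ :=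
  (∫ p in jumpDomain t, ownJumpAt f ψ (y p.1 i) p ∂(κ i)) + 1 / (N : ℝ) ^ (1 / α) *
    ∑ j ∈ Finset.univ.erase i, ∫ p in jumpDomain t, collateralJumpAt f (y p.1 j) p ∂(κ j)

/-- One step of the construction: the jumps are prescribed by the left limits of `x`, and the
equation with drift `B` is solved for these jumps. -/
def nextPath (α : ℝ) (f ψ : ℝ → ℝ) {N : ℕ} (B : (Fin N → ℝ) → Fin N → ℝ) (x₀ : Fin N → ℝ)
    (κ : Fin N → Measure (ℝ × ℝ × ℝ)) (x : ℝ → Fin N → ℝ) : ℝ → Fin N → ℝ :=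
  picardLimit B fun t => x₀ + jumpTerm α f ψ κ (leftValue x) t

/-- The limit of the iterated construction. -/
def pathLimit (α : ℝ) (f ψ : ℝ → ℝ) {N : ℕ} (B : (Fin N → ℝ) → Fin N → ℝ) (x₀ : Fin N → ℝ)
    (κ : Fin N → Measure (ℝ × ℝ × ℝ)) (t : ℝ) (i : Fin N) : ℝ :=
  limsup (fun n : ℕ => ((nextPath α f ψ B x₀ κ)^[n] 0) t i) atTop

lemma measurableSet_jumpDomain (t : ℝ) : MeasurableSet (jumpDomain t) :=
  measurableSet_Icc.prod (measurableSet_Ici.prod measurableSet_Ici)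

variable {N : ℕ}

lemma tendsto_sub_one_div (r : ℝ) :
    Tendsto (fun n : ℕ => r - 1 / ((n : ℝ) + 1)) atTop (𝓝[<] r) := by
  refine tendsto_nhdsWithin_iff.2 ⟨?_, Eventually.of_forall fun n => ?_⟩
  · simpa using tendsto_one_div_add_atTop_nhds_zero_nat.const_sub r
  · have : (0 : ℝ) < 1 / ((n : ℝ) + 1) := by positivity
    simp only [mem_Iio]; linarith

lemma leftValue_congr {x y : ℝ → Fin N → ℝ} {r : ℝ} (hr : 0 < r)
    (h : ∀ s ∈ Ico 0 r, x s = y s) : leftValue x r = leftValue y r := by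
  funext i
  refine limsup_congr ?_
  have h1 : Ioo 0 r ∈ 𝓝[<] r := Ioo_mem_nhdsLT hr
  filter_upwards [tendsto_sub_one_div r h1] with n hn
  rw [h _ ⟨hn.1.le, hn.2⟩]

lemma leftValue_eq_leftLim {x : ℝ → Fin N → ℝ} {r : ℝ} {i : Fin N} {l : ℝ}
    (h : Tendsto (fun s => x s i) (𝓝[<] r) (𝓝 l)) :
    leftValue x r i = Function.leftLim (fun s => x s i) r := by
  have h1 : leftValue x r i = l := (h.comp (tendsto_sub_one_div r)).limsup_eq
  rw [h1, leftLim_eq_of_tendsto h]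

variable {α : ℝ} {f ψ : ℝ → ℝ} {κ : Fin N → Measure (ℝ × ℝ × ℝ)} {n : Fin N → ℕ}
  {p : ∀ i, Fin (n i) → ℝ × ℝ × ℝ}

lemma jumpTerm_congr (hκ : ∀ i, κ i = ∑ k, Measure.dirac (p i k)) {y y' : ℝ → Fin N → ℝ} {t : ℝ}
    (h : ∀ i k, (p i k).1 ≤ t → y (p i k).1 = y' (p i k).1) :
    jumpTerm α f ψ κ y t = jumpTerm α f ψ κ y' t := by
  funext i
  simp only [jumpTerm, hκ, setIntegral_sum_dirac _ _ (measurableSet_jumpDomain t)]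
  have h1 : ∀ j k, p j k ∈ jumpDomain t → y (p j k).1 = y' (p j k).1 := fun j k hk =>
    h j k hk.1.2
  have h2 : ∀ (j : Fin N) (g : ℝ → ℝ × ℝ × ℝ → ℝ) (k : Fin (n j)),
      (jumpDomain t).indicator (fun x => g (y x.1 j) x) (p j k) =
        (jumpDomain t).indicator (fun x => g (y' x.1 j) x) (p j k) := by
    intro j g k
    by_cases hk : p j k ∈ jumpDomain t
    · rw [indicator_of_mem hk, indicator_of_mem hk, h1 j k hk]
    · rw [indicator_of_notMem hk, indicator_of_notMem hk]
  simp only [h2 _ (ownJumpAt f ψ), h2 _ (collateralJumpAt f)]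

/-- Measurable functions which are right-continuous and have left limits everywhere. -/
structure IsRegular (g : ℝ → ℝ) : Prop where
  measurable : Measurable g
  right : ∀ t, ContinuousWithinAt g (Ici t) t
  left : ∀ t, ∃ l, Tendsto g (𝓝[<] t) (𝓝 l)

lemma IsRegular.add {g h : ℝ → ℝ} (hg : IsRegular g) (hh : IsRegular h) :
    IsRegular fun t => g t + h t where
  measurable := hg.measurable.add hh.measurable
  right t := (hg.right t).add (hh.right t)
  left t := by
    obtain ⟨l, hl⟩ := hg.left t
    obtain ⟨m, hm⟩ := hh.left t
    exact ⟨l + m, hl.add hm⟩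

lemma IsRegular.const_mul {g : ℝ → ℝ} (hg : IsRegular g) (c : ℝ) :
    IsRegular fun t => c * g t where
  measurable := hg.measurable.const_mul c
  right t := (hg.right t).const_mul c
  left t := by
    obtain ⟨l, hl⟩ := hg.left t
    exact ⟨c * l, hl.const_mul c⟩

lemma Continuous.isRegular {g : ℝ → ℝ} (hg : Continuous g) : IsRegular g where
  measurable := hg.measurable
  right _ := hg.continuousWithinAt
  left t := ⟨g t, (hg.tendsto t).mono_left nhdsWithin_le_nhds⟩

lemma IsRegular.sum {ι : Type*} (A : Finset ι) {g : ι → ℝ → ℝ} (hg : ∀ i ∈ A, IsRegular (g i)) :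
    IsRegular fun t => ∑ i ∈ A, g i t := by
  classical
  induction A using Finset.induction_on with
  | empty => simpa using Continuous.isRegular continuous_const
  | insert i A hi ih =>
    simp only [Finset.sum_insert hi]
    exact (hg i (Finset.mem_insert_self i A)).add
      (ih fun j hj => hg j (Finset.mem_insert_of_mem hj))

lemma IsRegular.indicator_Ici (r c : ℝ) : IsRegular ((Ici r).indicator fun _ => c) where
  measurable := measurable_const.indicator measurableSet_Ici
  right t := by
    rcases le_or_gt r t with h | h
    · refine (continuousWithinAt_const (b := c)).congr (fun s hs => ?_) ?_
      · exact indicator_of_mem (mem_Ici.2 (h.trans hs)) _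
      · exact indicator_of_mem (mem_Ici.2 h) _
    · refine ContinuousAt.continuousWithinAt ?_
      refine (continuousAt_const (y := (0 : ℝ))).congr ?_
      filter_upwards [Iio_mem_nhds h] with s hs
      exact (indicator_of_notMem (by simpa using hs) _).symm
  left t := by
    rcases lt_or_ge r t with h | h
    · refine ⟨c, tendsto_const_nhds.congr' ?_⟩
      filter_upwards [Ioo_mem_nhdsLT h] with s hs
      exact (indicator_of_mem (f := fun _ => c) (mem_Ici.2 hs.1.le)).symm
    · refine ⟨0, tendsto_const_nhds.congr' ?_⟩
      filter_upwards [self_mem_nhdsWithin] with s hs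
      exact (indicator_of_notMem (by simpa using lt_of_lt_of_le hs h) _).symm

/-- As a function of `t`, an atom contributes a single step at its time `p.1`; this is why the jump
term is càdlàg. -/
lemma indicator_jumpDomain (g : ℝ × ℝ × ℝ → ℝ) (p : ℝ × ℝ × ℝ) (t : ℝ) :
    (jumpDomain t).indicator g p =
      (Ici p.1).indicator (fun _ => (Ici (0 : ℝ) ×ˢ Ici (0 : ℝ) ×ˢ Ici (0 : ℝ)).indicator g p) t := by
  by_cases h1 : p.1 ≤ t <;> simp [indicator, jumpDomain, h1, mem_prod, -Ici_prod_Ici]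

lemma isRegular_jumpTerm (hκ : ∀ i, κ i = ∑ k, Measure.dirac (p i k)) (y : ℝ → Fin N → ℝ)
    (i : Fin N) : IsRegular fun t => jumpTerm α f ψ κ y t i := by
  simp only [jumpTerm, hκ, setIntegral_sum_dirac _ _ (measurableSet_jumpDomain _),
    indicator_jumpDomain]
  refine IsRegular.add (IsRegular.sum _ fun k _ => .indicator_Ici _ _)
    (IsRegular.const_mul (IsRegular.sum _ fun j _ => IsRegular.sum _ fun k _ =>
      .indicator_Ici _ _) _)

variable {B : (Fin N → ℝ) → Fin N → ℝ} {L : ℝ≥0} {K : ℝ} {x₀ : Fin N → ℝ}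

/-- The input of the Picard iteration is measurable. -/
lemma stronglyMeasurable_add_jumpTerm (hκ : ∀ i, κ i = ∑ k, Measure.dirac (p i k))
    (y : ℝ → Fin N → ℝ) : StronglyMeasurable fun t => x₀ + jumpTerm α f ψ κ y t :=
  (measurable_pi_lambda _ fun i =>
    measurable_const.add (isRegular_jumpTerm hκ y i).measurable).stronglyMeasurable

/-- The given path enters only through its left limits at the atoms up to `t`, hence only through
its values strictly before those atoms. -/
lemma nextPath_congr (hκ : ∀ i, κ i = ∑ k, Measure.dirac (p i k)) (hp : ∀ i k, 0 < (p i k).1)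
    {x y : ℝ → Fin N → ℝ} {t : ℝ} (ht : 0 ≤ t)
    (h : ∀ i k, (p i k).1 ≤ t → ∀ s ∈ Ico 0 (p i k).1, x s = y s) :
    nextPath α f ψ B x₀ κ x t = nextPath α f ψ B x₀ κ y t := by
  refine picardLimit_congr B (T := t) (fun s hs => ?_) t ⟨ht, le_rfl⟩
  congr 1
  exact jumpTerm_congr hκ fun i k hk =>
    leftValue_congr (hp i k) (h i k (hk.trans hs.2))

/-- The number of atoms up to time `t`. -/
def atomCount (p : ∀ i, Fin (n i) → ℝ × ℝ × ℝ) (t : ℝ) : ℕ :=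
  (Finset.univ.filter fun k : Σ i, Fin (n i) => (p k.1 k.2).1 ≤ t).card

lemma atomCount_lt {t s : ℝ} {i : Fin N} {k : Fin (n i)} (hk : (p i k).1 ≤ t)
    (hs : s < (p i k).1) : atomCount p s < atomCount p t := by
  refine Finset.card_lt_card (Finset.ssubset_iff_of_subset (fun m hm => ?_) |>.2 ⟨⟨i, k⟩, ?_, ?_⟩)
  · simp only [Finset.mem_filter, Finset.mem_univ, true_and] at hm ⊢
    exact hm.trans (hs.le.trans hk)
  · simpa using hk
  · simpa using hs

/-- After `m + 1` steps the construction does not depend on the initial path any more, up to the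
`(m + 1)`-th atom. -/
lemma iterate_nextPath_eq (hκ : ∀ i, κ i = ∑ k, Measure.dirac (p i k))
    (hp : ∀ i k, 0 < (p i k).1) (m : ℕ) (x y : ℝ → Fin N → ℝ) {t : ℝ} (ht : 0 ≤ t)
    (hm : atomCount p t ≤ m) :
    (nextPath α f ψ B x₀ κ)^[m + 1] x t = (nextPath α f ψ B x₀ κ)^[m + 1] y t := by
  induction m generalizing t with
  | zero =>
    rw [zero_add, Function.iterate_one]
    refine nextPath_congr hκ hp ht fun i k hk s hs => ?_
    have := atomCount_lt hk hs.2
    omega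
  | succ m ih =>
    rw [Function.iterate_succ_apply' (nextPath α f ψ B x₀ κ) (m + 1) x,
      Function.iterate_succ_apply' (nextPath α f ψ B x₀ κ) (m + 1) y]
    -- Strictly before an atom the count is smaller by at least one, so the induction hypothesis
    -- applies there.
    refine nextPath_congr hκ hp ht fun i k hk s hs => ih hs.1 ?_
    have := atomCount_lt hk hs.2
    omega

lemma atomCount_le (t : ℝ) : atomCount p t ≤ ∑ i, n i :=
  (Finset.card_le_univ _).trans_eq (by simp)

/-- Once there are more steps than atoms the iterates no longer change on `[0, ∞)`. Defining the
limit as a `limsup` keeps the number of atoms, which is random, out of the construction. -/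
lemma pathLimit_eq_iterate (hκ : ∀ i, κ i = ∑ k, Measure.dirac (p i k))
    (hp : ∀ i k, 0 < (p i k).1) {t : ℝ} (ht : 0 ≤ t) :
    pathLimit α f ψ B x₀ κ t = (nextPath α f ψ B x₀ κ)^[∑ i, n i + 1] 0 t := by
  funext i
  refine Tendsto.limsup_eq (tendsto_const_nhds.congr' ?_)
  filter_upwards [eventually_ge_atTop (∑ i, n i + 1)] with m hm
  obtain ⟨d, rfl⟩ := Nat.exists_eq_add_of_le hm
  rw [Function.iterate_add_apply (n := d),
    iterate_nextPath_eq hκ hp _ ((nextPath α f ψ B x₀ κ)^[d] 0) 0 ht (atomCount_le t)]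

/-- `x` solves the equation with drift `B` and noise `κ` up to time `T`. -/
def SolvesUpTo (α : ℝ) (f ψ : ℝ → ℝ) (B : (Fin N → ℝ) → Fin N → ℝ) (x₀ : Fin N → ℝ)
    (κ : Fin N → Measure (ℝ × ℝ × ℝ)) (T : ℝ) (x : ℝ → Fin N → ℝ) : Prop :=
  IntegrableOn (fun s => B (x s)) (Ioc 0 T) ∧ ∀ t ∈ Icc 0 T,
    x t = x₀ + jumpTerm α f ψ κ (leftValue x) t + ∫ s in Ioc 0 t, B (x s)

lemma SolvesUpTo.congr {x y : ℝ → Fin N → ℝ} {T : ℝ}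
    (hκ : ∀ i, κ i = ∑ k, Measure.dirac (p i k))
    (hp : ∀ i k, 0 < (p i k).1) (hx : SolvesUpTo α f ψ B x₀ κ T x)
    (h : ∀ t ∈ Icc 0 T, y t = x t) : SolvesUpTo α f ψ B x₀ κ T y := by
  refine ⟨hx.1.congr_fun (fun s hs => by rw [h s ⟨hs.1.le, hs.2⟩]) measurableSet_Ioc,
    fun t ht => ?_⟩
  rw [h t ht, hx.2 t ht]
  congr 1
  · congr 1
    exact jumpTerm_congr hκ fun i k hk => leftValue_congr (hp i k) fun s hs =>
      (h s ⟨hs.1, hs.2.le.trans (hk.trans ht.2)⟩).symm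
  · exact setIntegral_congr_fun measurableSet_Ioc fun s hs => by
      simp only [h s ⟨hs.1.le, hs.2.trans ht.2⟩]

/-- On `[0, T]` a solution is a fixed point of `nextPath`, while sufficiently many iterations forget
the path they started from. -/
lemma SolvesUpTo.eq_pathLimit (hB : LipschitzWith L B) (hL : 1 ≤ L) (hK0 : 0 ≤ K)
    (hK : ∀ x, ‖B x‖ ≤ K) (hκ : ∀ i, κ i = ∑ k, Measure.dirac (p i k))
    (hp : ∀ i k, 0 < (p i k).1) {x : ℝ → Fin N → ℝ} {T : ℝ}
    (hx : SolvesUpTo α f ψ B x₀ κ T x) : ∀ t ∈ Icc 0 T, x t = pathLimit α f ψ B x₀ κ t := by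
  have h1 : ∀ m : ℕ, ∀ t ∈ Icc 0 T, x t = (nextPath α f ψ B x₀ κ)^[m] x t := by
    intro m
    induction m with
    | zero => exact fun t _ => rfl
    | succ m ih =>
      intro t ht
      rw [eq_picardLimit hB hL hK0 hK (stronglyMeasurable_add_jumpTerm hκ _) hx.2 hx.1 t ht,
        Function.iterate_succ_apply']
      exact nextPath_congr hκ hp ht.1 fun i k hk s hs =>
        ih s ⟨hs.1, hs.2.le.trans (hk.trans ht.2)⟩
  intro t ht
  rw [pathLimit_eq_iterate hκ hp ht.1, h1 (∑ i, n i + 1) t ht]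
  exact iterate_nextPath_eq hκ hp _ _ _ ht.1 (atomCount_le t)

/-- The construction yields a regular path which solves the equation. -/
lemma exists_solvesUpTo (hB : LipschitzWith L B) (hL : 1 ≤ L) (hK0 : 0 ≤ K)
    (hK : ∀ x, ‖B x‖ ≤ K) (hκ : ∀ i, κ i = ∑ k, Measure.dirac (p i k))
    (hp : ∀ i k, 0 < (p i k).1) :
    ∃ x : ℝ → Fin N → ℝ, (∀ i, IsRegular fun t => x t i) ∧
      ∀ T, SolvesUpTo α f ψ B x₀ κ T x := by
  set x := (nextPath α f ψ B x₀ κ)^[∑ i, n i + 1] 0 with hx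
  have hj := stronglyMeasurable_add_jumpTerm (α := α) (f := f) (ψ := ψ) (x₀ := x₀) hκ (leftValue x)
  -- One further step: `z` solves the equation with the jumps prescribed by `x`, and `z = x` on `[0,
  -- ∞)` as the iteration is stationary, so these are the jumps prescribed by `z` itself.
  set z := nextPath α f ψ B x₀ κ x with hz
  have hzm : StronglyMeasurable z := stronglyMeasurable_picardLimit' hB hL hK0 hK hj
  have hzx : ∀ t, 0 ≤ t → z t = x t := by
    intro t ht
    rw [hz, hx, ← Function.iterate_succ_apply' (nextPath α f ψ B x₀ κ),
      Function.iterate_succ_apply (nextPath α f ψ B x₀ κ)]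
    exact iterate_nextPath_eq hκ hp _ _ _ ht (atomCount_le t)
  have hzeq : ∀ t, z t = x₀ + jumpTerm α f ψ κ (leftValue x) t + ∫ s in Ioc 0 t, B (z s) :=
    fun t => picardLimit_eq hB hL hK0 hK hj t
  have hi := fun t => integrableOn_of_bound hB hK hzm t
  refine ⟨z, fun i => ?_, fun T => ⟨hi T, fun t ht => ?_⟩⟩
  · have h1 : (fun t => z t i) = fun t => (x₀ i + jumpTerm α f ψ κ (leftValue x) t i)
        + (∫ s in Ioc 0 t, B (z s)) i := by
      funext t
      conv_lhs => rw [hzeq t]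
      rfl
    rw [h1]
    refine ((Continuous.isRegular continuous_const).add (isRegular_jumpTerm hκ _ i)).add ?_
    have h2 : Continuous fun t => ∫ s in Ioc 0 t, B (z s) := by
      have h3 : ∀ t, ∫ s in Ioc 0 t, B (z s) = ∫ s in (0 : ℝ)..(max t 0), B (z s) := by
        intro t
        rw [intervalIntegral.integral_of_le (le_max_right _ _)]
        rcases le_total 0 t with h | h
        · rw [max_eq_left h]
        · rw [max_eq_right h, Ioc_self, Ioc_eq_empty (not_lt.2 h)]
      simp only [h3]
      have h4 : Continuous fun t => ∫ s in (0 : ℝ)..t, B (z s) := by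
        refine intervalIntegral.continuous_primitive (fun c d => ?_) 0
        rw [intervalIntegrable_iff]
        exact Measure.integrableOn_of_bounded (M := K) (by simp [uIoc])
          (hB.continuous.comp_stronglyMeasurable hzm).aestronglyMeasurable
          (ae_of_all _ fun _ => hK _)
      exact h4.comp (continuous_id.max continuous_const)
    exact Continuous.isRegular ((continuous_apply i).comp h2)
  · conv_lhs => rw [hzeq t]
    congr 2
    exact jumpTerm_congr hκ fun i k hk => leftValue_congr (hp i k) fun s hs => (hzx s hs.1).symm

end Construction

/-! ### Measurable dependence on the noise, and adaptedness. -/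

section Measurability

/-- The masses `κ ω univ` are finite but not uniformly bounded; dividing by them gives a finite
kernel, for which measurability of parameter integrals is available. -/
lemma measurable_integral_of_finite {S X : Type*} [MeasurableSpace S] [MeasurableSpace X]
    {κ : S → Measure X} (hκ : Measurable κ) [∀ ω, IsFiniteMeasure (κ ω)] {g : S → X → ℝ}
    (hg : Measurable (Function.uncurry g)) : Measurable fun ω => ∫ x, g ω x ∂(κ ω) := by
  have hm : Measurable fun ω => κ ω univ := (Measure.measurable_coe .univ).comp hκ
  let κ' : Kernel S X := ⟨fun ω => (κ ω univ)⁻¹ • κ ω, Measure.measurable_of_measurable_coe _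
    fun B hB => by
      simp only [Measure.smul_apply, smul_eq_mul]
      exact hm.inv.mul ((Measure.measurable_coe hB).comp hκ)⟩
  have hfin : IsFiniteKernel κ' := ⟨1, ENNReal.one_lt_top, fun ω => by
    change (κ ω univ)⁻¹ * κ ω univ ≤ 1
    exact ENNReal.inv_mul_le_one _⟩
  have h1 : Measurable fun ω => ∫ x, g ω x ∂(κ' ω) :=
    (StronglyMeasurable.integral_kernel_prod_right hg.stronglyMeasurable).measurable
  have h2 : (fun ω => ∫ x, g ω x ∂(κ ω)) = fun ω => (κ ω univ).toReal * ∫ x, g ω x ∂(κ' ω) := by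
    funext ω
    change _ = _ * ∫ x, g ω x ∂((κ ω univ)⁻¹ • κ ω)
    rw [integral_smul_measure, smul_eq_mul, ← mul_assoc, ENNReal.toReal_inv]
    rcases eq_or_ne (κ ω univ) 0 with h | h
    · rw [Measure.measure_univ_eq_zero.1 h]
      simp
    · rw [mul_inv_cancel₀, one_mul]
      exact (ENNReal.toReal_pos h (measure_ne_top _ _)).ne'
  rw [h2]
  exact hm.ennreal_toReal.mul h1

variable {S : Type*} [MeasurableSpace S] {N : ℕ} {α : ℝ} {f ψ : ℝ → ℝ}
  {κ : Fin N → S → Measure (ℝ × ℝ × ℝ)}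

lemma measurable_leftValue {x : S → ℝ → Fin N → ℝ} (hx : Measurable (Function.uncurry x)) :
    Measurable (Function.uncurry fun ω => leftValue (x ω)) := by
  refine measurable_pi_lambda _ fun i => Measurable.limsup fun n => ?_
  exact (measurable_pi_apply i).comp (hx.comp
    (measurable_fst.prodMk (measurable_snd.sub_const (1 / ((n : ℝ) + 1)))))

lemma measurableSet_mem_jumpDomain :
    MeasurableSet {x : ℝ × (ℝ × ℝ × ℝ) | x.2 ∈ jumpDomain x.1} := by
  have h1 : Measurable fun x : ℝ × (ℝ × ℝ × ℝ) => x.2.1 := by fun_prop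
  have h2 : Measurable fun x : ℝ × (ℝ × ℝ × ℝ) => x.2.2 := by fun_prop
  exact ((measurableSet_le measurable_const h1).inter (measurableSet_le h1 measurable_fst)).inter
    (h2 (measurableSet_Ici.prod measurableSet_Ici))

lemma measurable_jumpIntegral {κ : S → Measure (ℝ × ℝ × ℝ)} (hκ : Measurable κ)
    [∀ ω, IsFiniteMeasure (κ ω)] {g : ℝ → ℝ × ℝ × ℝ → ℝ} (hg : Measurable (Function.uncurry g))
    {y : S → ℝ → ℝ} (hy : Measurable (Function.uncurry y)) :
    Measurable fun w : S × ℝ => ∫ p in jumpDomain w.2, g (y w.1 p.1) p ∂(κ w.1) := by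
  have h1 : Measurable fun w : S × ℝ => κ w.1 := hκ.comp measurable_fst
  have h2 : Measurable fun x : (S × ℝ) × (ℝ × ℝ × ℝ) => g (y x.1.1 x.2.1) x.2 := by
    have h3 : Measurable fun x : (S × ℝ) × (ℝ × ℝ × ℝ) => y x.1.1 x.2.1 :=
      hy.comp ((measurable_fst.comp measurable_fst).prodMk (measurable_fst.comp measurable_snd))
    exact hg.comp (h3.prodMk measurable_snd)
  have h3 : MeasurableSet {x : (S × ℝ) × (ℝ × ℝ × ℝ) | x.2 ∈ jumpDomain x.1.2} := by
    have h4 : Measurable fun x : (S × ℝ) × (ℝ × ℝ × ℝ) => (x.1.2, x.2) := by fun_prop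
    exact h4 measurableSet_mem_jumpDomain
  have h4 := measurable_integral_of_finite h1
    (g := fun w p => (jumpDomain w.2).indicator (fun p => g (y w.1 p.1) p) p) (h2.indicator h3)
  simpa only [integral_indicator (measurableSet_jumpDomain _)] using h4

lemma measurable_ownJumpAt (hf : Measurable f) (hψ : Measurable ψ) :
    Measurable (Function.uncurry (ownJumpAt f ψ)) :=
  Measurable.ite (measurableSet_le (by fun_prop) (by fun_prop)) (by fun_prop) measurable_const

lemma measurable_collateralJumpAt (hf : Measurable f) :
    Measurable (Function.uncurry (collateralJumpAt f)) :=
  Measurable.ite (measurableSet_le (by fun_prop) (by fun_prop)) (by fun_prop) measurable_const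

lemma measurable_jumpTerm (hf : Measurable f) (hψ : Measurable ψ) (hκ : ∀ i, Measurable (κ i))
    [∀ i ω, IsFiniteMeasure (κ i ω)] {y : S → ℝ → Fin N → ℝ}
    (hy : Measurable (Function.uncurry y)) :
    Measurable fun w : S × ℝ => jumpTerm α f ψ (fun i => κ i w.1) (y w.1) w.2 := by
  have hyi : ∀ i, Measurable (Function.uncurry fun (ω : S) (t : ℝ) => y ω t i) := fun i =>
    (measurable_pi_apply i).comp hy
  refine measurable_pi_lambda _ fun i => ?_
  refine (measurable_jumpIntegral (hκ i) (measurable_ownJumpAt hf hψ) (hyi i)).add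
    (Measurable.const_mul (Finset.measurable_fun_sum _ fun j _ => ?_) _)
  exact measurable_jumpIntegral (hκ j) (measurable_collateralJumpAt hf) (hyi j)

variable {B : (Fin N → ℝ) → Fin N → ℝ} {L : ℝ≥0} {K : ℝ}

lemma measurable_nextPath (hB : LipschitzWith L B) (hL : 1 ≤ L) (hK0 : 0 ≤ K)
    (hK : ∀ x, ‖B x‖ ≤ K) (hf : Measurable f) (hψ : Measurable ψ) (hκ : ∀ i, Measurable (κ i))
    [∀ i ω, IsFiniteMeasure (κ i ω)] {x₀ : S → Fin N → ℝ} (hx₀ : Measurable x₀)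
    {x : S → ℝ → Fin N → ℝ} (hx : Measurable (Function.uncurry x)) :
    Measurable (Function.uncurry fun ω : S =>
      nextPath α f ψ B (x₀ ω) (fun i => κ i ω) (x ω)) :=
  (stronglyMeasurable_picardLimit hB hL hK0 hK
    (j := fun ω t => x₀ ω + jumpTerm α f ψ (fun i => κ i ω) (leftValue (x ω)) t)
    ((hx₀.comp measurable_fst).add
      (measurable_jumpTerm hf hψ hκ (measurable_leftValue hx))).stronglyMeasurable).measurable

lemma measurable_pathLimit (hB : LipschitzWith L B) (hL : 1 ≤ L) (hK0 : 0 ≤ K)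
    (hK : ∀ x, ‖B x‖ ≤ K) (hf : Measurable f) (hψ : Measurable ψ) (hκ : ∀ i, Measurable (κ i))
    [∀ i ω, IsFiniteMeasure (κ i ω)] {x₀ : S → Fin N → ℝ} (hx₀ : Measurable x₀) (t : ℝ) :
    Measurable fun ω => pathLimit α f ψ B (x₀ ω) (fun i => κ i ω) t := by
  have h1 : ∀ m : ℕ, Measurable (Function.uncurry fun ω : S =>
      (nextPath α f ψ B (x₀ ω) (fun i => κ i ω))^[m] 0) := by
    intro m
    induction m with
    | zero =>
      simp only [Function.iterate_zero, id_eq]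
      exact measurable_const (a := (0 : Fin N → ℝ))
    | succ m ih =>
      have h2 := measurable_nextPath (α := α) hB hL hK0 hK hf hψ hκ hx₀ ih
      simpa only [Function.iterate_succ_apply'] using h2
  refine measurable_pi_lambda _ fun i => Measurable.limsup fun m => ?_
  have h2 : Measurable fun ω : S =>
      Function.uncurry (fun ω : S => (nextPath α f ψ B (x₀ ω) (fun i => κ i ω))^[m] 0) (ω, t) :=
    (h1 m).comp (measurable_id.prodMk measurable_const)
  exact (measurable_pi_apply i).comp h2

/-- The region of times at most `T` and rates at most `K`. -/
def jumpBox (K T : ℝ) : Set (ℝ × ℝ × ℝ) := Icc 0 T ×ˢ Icc 0 K ×ˢ Ici 0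

lemma measurableSet_jumpBox (K T : ℝ) : MeasurableSet (jumpBox K T) :=
  measurableSet_Icc.prod (measurableSet_Icc.prod measurableSet_Ici)

open Classical in
/-- The restriction of `η` to `jumpBox K T`, replaced by `0` if it is infinite. -/
def cutNoise (K T : ℝ) (η : Measure (ℝ × ℝ × ℝ)) : Measure (ℝ × ℝ × ℝ) :=
  if η (jumpBox K T) = ∞ then 0 else η.restrict (jumpBox K T)

instance (K T : ℝ) (η : Measure (ℝ × ℝ × ℝ)) : IsFiniteMeasure (cutNoise K T η) := by
  rw [cutNoise]
  split_ifs with h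
  · infer_instance
  · exact ⟨by rw [Measure.restrict_apply_univ]; exact lt_top_iff_ne_top.2 h⟩

/-- Only the generators of the filtration are assumed measurable. The boxes form a π-system
generating the Borel sets and the cut measure is finite, so measurability extends to all Borel sets.
-/
lemma measurable_cutNoise {η : S → Measure (ℝ × ℝ × ℝ)} {K T : ℝ}
    (h : ∀ s ∈ Icc 0 T, ∀ A C : Set ℝ, MeasurableSet A → A ⊆ Ici 0 → MeasurableSet C → C ⊆ Ici 0 →
      Measurable fun ω => η ω (Icc 0 s ×ˢ A ×ˢ C)) (hT : 0 ≤ T) :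
    Measurable fun ω => cutNoise K T (η ω) := by
  classical
  have hbox : Measurable fun ω => η ω (jumpBox K T) :=
    h T ⟨hT, le_rfl⟩ _ _ measurableSet_Icc Icc_subset_Ici_self measurableSet_Ici subset_rfl
  have hset : MeasurableSet {ω | η ω (jumpBox K T) = ∞} := hbox (measurableSet_singleton _)
  have key : ∀ s A C, MeasurableSet A → MeasurableSet C →
      Measurable fun ω => cutNoise K T (η ω) (Iic s ×ˢ A ×ˢ C) := by
    intro s A C hA hC
    have h1 : (fun ω => cutNoise K T (η ω) (Iic s ×ˢ A ×ˢ C)) =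
        fun ω => if η ω (jumpBox K T) = ∞ then 0 else
          η ω (Icc 0 (min s T) ×ˢ (A ∩ Icc 0 K) ×ˢ (C ∩ Ici 0)) := by
      funext ω
      rw [cutNoise]
      split_ifs
      · simp
      · rw [Measure.restrict_apply (measurableSet_Iic.prod (hA.prod hC))]
        congr 1
        ext ⟨s', z, u⟩
        simp only [jumpBox, mem_inter_iff, mem_prod, mem_Iic, mem_Icc, mem_Ici, le_min_iff]
        tauto
    rw [h1]
    refine Measurable.ite hset measurable_const ?_
    rcases lt_or_ge s 0 with hs | hs
    · have : Icc 0 (min s T) = ∅ := Icc_eq_empty (not_le.2 ((min_le_left _ _).trans_lt hs))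
      simp only [this, empty_prod, measure_empty]
      exact measurable_const
    · exact h _ ⟨le_min hs hT, min_le_right _ _⟩ _ _ (hA.inter measurableSet_Icc)
        (fun z hz => hz.2.1) (hC.inter measurableSet_Ici) inter_subset_right
  have hgen : MeasurableSpace.generateFrom (image2 (· ×ˢ ·) (range (Iic : ℝ → Set ℝ))
      (image2 (· ×ˢ ·) {A : Set ℝ | MeasurableSet A} {C : Set ℝ | MeasurableSet C})) =
      (inferInstance : MeasurableSpace (ℝ × ℝ × ℝ)) := by
    refine generateFrom_eq_prod ?_ generateFrom_prod ?_ ?_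
    · rw [← borel_eq_generateFrom_Iic]
      exact (BorelSpace.measurable_eq (α := ℝ)).symm
    · refine ⟨fun n : ℕ => Iic (n : ℝ), fun n => mem_range_self _, ?_⟩
      exact eq_univ_of_forall fun x => mem_iUnion.2 (exists_nat_ge x)
    · have h2 : MeasurableSet (univ : Set ℝ) := .univ
      exact ⟨fun _ => univ, fun _ => ⟨univ, h2, univ, h2, univ_prod_univ⟩, iUnion_const _⟩
  refine Measurable.measure_of_isPiSystem hgen.symm ?_ ?_ ?_
  · exact IsPiSystem.prod isPiSystem_Iic isPiSystem_prod
  · rintro _ ⟨_, ⟨s, rfl⟩, _, ⟨A, hA, C, hC, rfl⟩, rfl⟩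
    exact key s A C hA hC
  · have h2 : ∀ ω, cutNoise K T (η ω) univ = cutNoise K T (η ω) (Iic T ×ˢ univ ×ˢ univ) := by
      intro ω
      rw [cutNoise]
      split_ifs
      · simp
      · rw [Measure.restrict_apply .univ,
          Measure.restrict_apply (measurableSet_Iic.prod (MeasurableSet.univ.prod .univ))]
        congr 1
        ext ⟨s', z, u⟩
        simp only [jumpBox, mem_inter_iff, mem_prod, mem_Iic, mem_Icc, mem_Ici, mem_univ]
        tauto
    simp only [h2]
    exact key T univ univ .univ .univ

lemma measurable_canonicalFiltration_noise {Ω : Type*} [MeasurableSpace Ω]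
    (π : ℕ → Ω → Measure (ℝ × ℝ × ℝ)) (X₀ : ℕ → Ω → ℝ) {t s : ℝ} (hs : s ∈ Icc 0 t) (i : ℕ)
    {A C : Set ℝ} (hA : MeasurableSet A) (hA0 : A ⊆ Ici 0) (hC : MeasurableSet C)
    (hC0 : C ⊆ Ici 0) :
    Measurable[canonicalFiltration π X₀ t] fun ω => π i ω (Icc 0 s ×ˢ A ×ˢ C) := by
  rw [measurable_iff_comap_le]
  refine le_trans ?_ le_sup_left
  exact le_iSup_of_le i <| le_iSup_of_le s <| le_iSup_of_le hs <| le_iSup_of_le A <|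
    le_iSup_of_le ⟨hA, hA0⟩ <| le_iSup_of_le C <| le_iSup_of_le ⟨hC, hC0⟩ le_rfl

lemma measurable_canonicalFiltration_init {Ω : Type*} [MeasurableSpace Ω]
    (π : ℕ → Ω → Measure (ℝ × ℝ × ℝ)) (X₀ : ℕ → Ω → ℝ) (t : ℝ) (i : ℕ) :
    Measurable[canonicalFiltration π X₀ t] (X₀ i) := by
  rw [measurable_iff_comap_le]
  refine le_trans ?_ le_sup_right
  exact le_iSup (fun i => MeasurableSpace.comap (X₀ i) inferInstance) i

/-- The particle system at time `t`, built from the noise up to time `t`. -/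
def particles {Ω : Type*} (α : ℝ) (b : ℝ → Measure ℝ → ℝ) (f ψ : ℝ → ℝ) (K : ℝ)
    (π : ℕ → Ω → Measure (ℝ × ℝ × ℝ)) (X₀ : ℕ → Ω → ℝ) (N : ℕ) (i : Fin N) (t : ℝ) (ω : Ω) : ℝ :=
  max (pathLimit α f ψ (truncatedDrift b) (fun i : Fin N => X₀ i ω)
    (fun i : Fin N => cutNoise K t (π i ω)) t i) 0

/-- The noise is cut at the very time at which the position is read, so only the generators of the
σ-algebra at time `t` enter. As the filtration is not completed, the construction has to be
measurable for all `ω`, including those with infinitely many atoms, where the cut noise is `0`. -/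
lemma measurable_particles {Ω : Type*} [MeasurableSpace Ω] {q : ℝ} {a : ℝ → ℝ}
    {b : ℝ → Measure ℝ → ℝ} (ha : IsDistanceFunction q a) (hb : DriftAssumption a b)
    (hf : Measurable f) (hψ : Measurable ψ) (K : ℝ) (π : ℕ → Ω → Measure (ℝ × ℝ × ℝ))
    (X₀ : ℕ → Ω → ℝ) (hN : 1 ≤ N) (i : Fin N) {t : ℝ} (ht : 0 ≤ t) :
    Measurable[canonicalFiltration π X₀ t] (particles α b f ψ K π X₀ N i t) := by
  obtain ⟨L, hL1, hL⟩ := exists_lipschitz_truncatedDrift ha hb hN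
  obtain ⟨M, hM0, hM⟩ := exists_bound_drift hb
  let m := canonicalFiltration π X₀ t
  have h1 : ∀ i : Fin N, Measurable[canonicalFiltration π X₀ t]
      fun ω => cutNoise K t (π i ω) := fun i =>
    measurable_cutNoise (S := Ω) (fun s hs A C hA hA0 hC hC0 =>
      measurable_canonicalFiltration_noise π X₀ hs i hA hA0 hC hC0) ht
  have h2 : Measurable[canonicalFiltration π X₀ t] fun ω => fun i : Fin N => X₀ i ω :=
    measurable_pi_lambda _ fun i => measurable_canonicalFiltration_init π X₀ t i
  have h3 := @measurable_pathLimit Ω (canonicalFiltration π X₀ t) N α f ψ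
    (fun i ω => cutNoise K t (π i ω)) (truncatedDrift b) L M hL hL1 hM0
    (norm_truncatedDrift_le hM0 hM hN) hf hψ h1 _ _ h2 t
  exact ((measurable_pi_apply i).comp h3).max measurable_const

end Measurability

/-! ### Existence, uniqueness and positivity for one realisation of the noise. -/

section Pathwise

/-- A realisation of the noise which is integer-valued, finite on each `jumpBox K T`, and does not
charge the time `0`. -/
structure IsLocallyFiniteNoise (K : ℝ) (η : Measure (ℝ × ℝ × ℝ)) : Prop where
  finite : ∀ T, η (jumpBox K T) ≠ ∞
  integer_valued : ∀ B, MeasurableSet B → η B = ∞ ∨ ∃ n : ℕ, η B = n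
  zero : η (Iic 0 ×ˢ univ) = 0

variable {K : ℝ} {η : Measure (ℝ × ℝ × ℝ)}

lemma IsLocallyFiniteNoise.cutNoise_eq (h : IsLocallyFiniteNoise K η) (T : ℝ) :
    cutNoise K T η = η.restrict (jumpBox K T) := if_neg (h.finite T)

/-- Atoms at positive times are what makes the left limits in the jump terms depend on the path on
`[0, ∞)` only. -/
lemma IsLocallyFiniteNoise.exists_atoms (h : IsLocallyFiniteNoise K η) (T : ℝ) :
    ∃ (n : ℕ) (p : Fin n → ℝ × ℝ × ℝ), cutNoise K T η = ∑ k, Measure.dirac (p k) ∧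
      ∀ k, 0 < (p k).1 ∧ p k ∈ jumpBox K T := by
  obtain ⟨n, p, hp⟩ := exists_eq_sum_dirac (cutNoise K T η) fun B hB => by
    rw [h.cutNoise_eq, Measure.restrict_apply hB]
    exact h.integer_valued _ (hB.inter (measurableSet_jumpBox K T))
  refine ⟨n, p, hp, fun k => ?_⟩
  have h1 : ∀ᵐ x ∂(cutNoise K T η), 0 < x.1 ∧ x ∈ jumpBox K T := by
    rw [h.cutNoise_eq]
    have h2 : ∀ᵐ x ∂η, 0 < x.1 := by
      rw [ae_iff]
      convert h.zero using 2
      ext x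
      simp
    filter_upwards [ae_restrict_of_ae h2, ae_restrict_mem (measurableSet_jumpBox K T)] with x h3 h4
    exact ⟨h3, h4⟩
  rw [hp] at h1
  exact ae_sum_dirac_iff.1 h1 k

lemma jumpBox_subset_jumpDomain (K t : ℝ) : jumpBox K t ⊆ jumpDomain t :=
  prod_mono subset_rfl (prod_mono Icc_subset_Ici_self subset_rfl)

lemma lt_of_mem_jumpDomain_sdiff {t : ℝ} {x : ℝ × ℝ × ℝ} (hx : x ∈ jumpDomain t \ jumpBox K t) :
    K < x.2.1 := by
  by_contra! h
  exact hx.2 ⟨hx.1.1, ⟨hx.1.2.1, h⟩, hx.1.2.2⟩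

lemma IsLocallyFiniteNoise.integrableOn (h : IsLocallyFiniteNoise K η) {g : ℝ × ℝ × ℝ → ℝ}
    (hg : ∀ p, K < p.2.1 → g p = 0) (t : ℝ) : IntegrableOn g (jumpDomain t) η := by
  have h1 : IntegrableOn g (jumpBox K t) η := by
    rw [IntegrableOn, ← h.cutNoise_eq t]
    obtain ⟨n, p, hp, -⟩ := h.exists_atoms t
    rw [hp]
    exact integrable_sum_dirac p g
  exact h1.of_forall_sdiff_eq_zero (measurableSet_jumpDomain t)
    fun x hx => hg x (lt_of_mem_jumpDomain_sdiff hx)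

lemma IsLocallyFiniteNoise.setIntegral_eq_jumpBox {g : ℝ × ℝ × ℝ → ℝ}
    (hg : ∀ p, K < p.2.1 → g p = 0) (t : ℝ) :
    ∫ p in jumpDomain t, g p ∂η = ∫ p in jumpBox K t, g p ∂η :=
  setIntegral_eq_of_subset_of_forall_sdiff_eq_zero (measurableSet_jumpDomain t)
    (jumpBox_subset_jumpDomain K t) fun x hx => hg x (lt_of_mem_jumpDomain_sdiff hx)

lemma IsLocallyFiniteNoise.setIntegral_cutNoise (h : IsLocallyFiniteNoise K η)
    {g : ℝ × ℝ × ℝ → ℝ} (hg : ∀ p, K < p.2.1 → g p = 0) {t T : ℝ} (htT : t ≤ T) :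
    ∫ p in jumpDomain t, g p ∂(cutNoise K T η) = ∫ p in jumpDomain t, g p ∂η := by
  rw [setIntegral_eq_jumpBox hg, setIntegral_eq_jumpBox hg, h.cutNoise_eq,
    Measure.restrict_restrict (measurableSet_jumpBox K t), inter_eq_left.2]
  exact prod_mono (Icc_subset_Icc_right htT) subset_rfl

variable {f ψ : ℝ → ℝ} {α : ℝ} {N : ℕ}

lemma ownJumpAt_eq_zero (hfK : ∀ x, f x ≤ K) (y : ℝ × ℝ × ℝ → ℝ) (p : ℝ × ℝ × ℝ)
    (hp : K < p.2.1) : ownJumpAt f ψ (y p) p = 0 :=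
  if_neg (not_le.2 ((hfK _).trans_lt hp))

lemma collateralJumpAt_eq_zero (hfK : ∀ x, f x ≤ K) (y : ℝ × ℝ × ℝ → ℝ) (p : ℝ × ℝ × ℝ)
    (hp : K < p.2.1) : collateralJumpAt f (y p) p = 0 :=
  if_neg (not_le.2 ((hfK _).trans_lt hp))

variable {η : Fin N → Measure (ℝ × ℝ × ℝ)}

lemma jumpTerm_cutNoise (hfK : ∀ x, f x ≤ K) (h : ∀ i, IsLocallyFiniteNoise K (η i))
    (y : ℝ → Fin N → ℝ) {t T : ℝ} (htT : t ≤ T) :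
    jumpTerm α f ψ (fun i => cutNoise K T (η i)) y t = jumpTerm α f ψ η y t := by
  funext i
  simp only [jumpTerm]
  rw [(h i).setIntegral_cutNoise (ownJumpAt_eq_zero hfK fun p => y p.1 i) htT]
  congr 2
  exact Finset.sum_congr rfl fun j _ =>
    (h j).setIntegral_cutNoise (collateralJumpAt_eq_zero hfK fun p => y p.1 j) htT

lemma jumpTerm_mono (hfK : ∀ x, f x ≤ K) (hψ : ∀ x, 0 ≤ ψ x)
    (h : ∀ i, IsLocallyFiniteNoise K (η i)) (y : ℝ → Fin N → ℝ) {s t : ℝ} (hst : s ≤ t)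
    (i : Fin N) : jumpTerm α f ψ η y s i ≤ jumpTerm α f ψ η y t i := by
  have hsub : jumpDomain s ⊆ jumpDomain t := prod_mono (Icc_subset_Icc_right hst) subset_rfl
  refine add_le_add ?_ (mul_le_mul_of_nonneg_left (Finset.sum_le_sum fun j _ => ?_) (by positivity))
  · refine setIntegral_mono_set ((h i).integrableOn
      (ownJumpAt_eq_zero hfK fun p => y p.1 i) t) (ae_of_all _ fun p => ?_) hsub.eventuallyLE
    simp only [Pi.zero_apply, ownJumpAt]
    split_ifs
    exacts [hψ _, le_rfl]
  · refine setIntegral_mono_set ((h j).integrableOn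
      (collateralJumpAt_eq_zero hfK fun p => y p.1 j) t) ?_ hsub.eventuallyLE
    filter_upwards [ae_restrict_mem (measurableSet_jumpDomain t)] with p hp
    simp only [Pi.zero_apply, collateralJumpAt]
    split_ifs
    exacts [hp.2.2, le_rfl]

lemma jumpTerm_nonneg (hψ : ∀ x, 0 ≤ ψ x) (y : ℝ → Fin N → ℝ) (t : ℝ) (i : Fin N) :
    0 ≤ jumpTerm α f ψ η y t i := by
  refine add_nonneg (integral_nonneg fun p => ?_) (mul_nonneg (by positivity)
    (Finset.sum_nonneg fun j _ => setIntegral_nonneg (measurableSet_jumpDomain t) fun p hp => ?_))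
  · simp only [Pi.zero_apply, ownJumpAt]
    split_ifs
    exacts [hψ _, le_rfl]
  · simp only [collateralJumpAt]
    split_ifs
    exacts [hp.2.2, le_rfl]

/-- The left limits of the paths of a family of particles. -/
def leftLims (x : ℝ → Fin N → ℝ) (s : ℝ) (i : Fin N) : ℝ := Function.leftLim (fun t => x t i) s

lemma jumpTerm_leftLims (x : ℝ → Fin N → ℝ) (t : ℝ) (i : Fin N) :
    jumpTerm α f ψ η (leftLims x) t i =
      (∫ p in jumpDomain t, ownJump f ψ (fun t => x t i) p ∂(η i)) + 1 / (N : ℝ) ^ (1 / α) *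
        ∑ j ∈ Finset.univ.erase i,
          ∫ p in jumpDomain t, collateralJump f (fun t => x t j) p ∂(η j) :=
  rfl

lemma leftValue_eq_leftLims {x : ℝ → Fin N → ℝ} (hx : ∀ i, IsCadlag fun t => x t i) {s : ℝ}
    (hs : 0 < s) : leftValue x s = leftLims x s := by
  funext i
  obtain ⟨l, hl⟩ := (hx i).2 s hs
  exact leftValue_eq_leftLim hl

/-- The limits along `r - 1 / (n + 1)` need to agree with the true left limits only at the atoms,
whose times are positive. -/
lemma jumpTerm_leftValue (hfK : ∀ x, f x ≤ K) (h : ∀ i, IsLocallyFiniteNoise K (η i))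
    {x : ℝ → Fin N → ℝ} (hx : ∀ i, IsCadlag fun t => x t i) {t T : ℝ} (htT : t ≤ T) :
    jumpTerm α f ψ (fun i => cutNoise K T (η i)) (leftValue x) t =
      jumpTerm α f ψ η (leftLims x) t := by
  choose n p hp hp0 using fun i => (h i).exists_atoms T
  rw [← jumpTerm_cutNoise hfK h _ htT]
  exact jumpTerm_congr hp fun i k _ => leftValue_eq_leftLims hx (hp0 i k).1

variable {q : ℝ} {a : ℝ → ℝ} {b : ℝ → Measure ℝ → ℝ} {x₀ : Fin N → ℝ}

/-- Paths which solve the equation with a drift that equals `b` where all particles are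
nonnegative stay positive. -/
lemma pos_of_equation (ha : IsDistanceFunction q a) (hb : DriftAssumption a b) (hN : 1 ≤ N)
    (hfK : ∀ x, f x ≤ K) (hψ : ∀ x, 0 ≤ ψ x) (h : ∀ i, IsLocallyFiniteNoise K (η i))
    (hx₀ : ∀ i, 0 < x₀ i) {x y : ℝ → Fin N → ℝ} (hx : ∀ i, IsCadlag fun t => x t i)
    {β : Fin N → ℝ → ℝ} (hβ : ∀ i t, 0 ≤ t → IntervalIntegrable (β i) volume 0 t)
    (hβb : ∀ s, (∀ i, 0 ≤ x s i) → ∀ i, β i s = b (x s i) (empirical (x s)))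
    (heq : ∀ i t, 0 ≤ t → x t i = x₀ i + (∫ s in (0 : ℝ)..t, β i s) + jumpTerm α f ψ η y t i) :
    ∀ i t, 0 ≤ t → 0 < x t i := by
  obtain ⟨Λ, hΛ, hlow⟩ := exists_drift_ge ha hb
  obtain ⟨M, hM0, hM⟩ := exists_bound_drift hb
  refine pos_of_drift_ge (x := fun i t => x t i) (β := β) (K := M) hΛ (fun i => ?_)
    (fun i t ht => (hx i).1 t ht) hβ (fun i s r hs hsr => ?_) fun s _ hpos i => ?_
  · rw [heq i 0 le_rfl, intervalIntegral.integral_same, add_zero]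
    exact add_pos_of_pos_of_nonneg (hx₀ i) (jumpTerm_nonneg hψ _ _ _)
  · have h1 := intervalIntegral.integral_add_adjacent_intervals (hβ i s hs)
      ((hβ i s hs).symm.trans (hβ i r (hs.trans hsr)))
    rw [heq i s hs, heq i r (hs.trans hsr), ← h1]
    have h2 := jumpTerm_mono (α := α) hfK hψ h y hsr i
    linarith
  · rw [hβb s hpos i]
    exact ⟨hlow _ (hpos i) _ (empirical_mem_P1 hN hpos),
      (abs_le.1 (hM _ (hpos i) _ (empirical_mem_P1 hN hpos))).1⟩

/-- For nonnegative càdlàg paths, the truncated equation is the original one. -/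
lemma isSolutionPath_iff (hfK : ∀ x, f x ≤ K) (h : ∀ i, IsLocallyFiniteNoise K (η i))
    {x : ℝ → Fin N → ℝ} (hx : ∀ i, IsCadlag fun t => x t i)
    (hx0 : ∀ i t, 0 ≤ t → 0 ≤ x t i) :
    IsSolutionPath α b f ψ x₀ η (fun i t => x t i) ↔ ∀ T, 0 ≤ T →
      SolvesUpTo α f ψ (truncatedDrift b) x₀ (fun i => cutNoise K T (η i)) T x := by
  have hdrift : ∀ i s, 0 ≤ s →
      b (x s i) (empirical fun j => x s j) = truncatedDrift b (x s) i := fun i s hs =>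
    (truncatedDrift_of_nonneg (fun j => hx0 j s hs) i).symm
  have hint : ∀ i t, 0 ≤ t → ∫ s in (0 : ℝ)..t, b (x s i) (empirical fun j => x s j) =
      ∫ s in Ioc 0 t, truncatedDrift b (x s) i := by
    intro i t ht
    rw [intervalIntegral.integral_of_le ht]
    exact setIntegral_congr_fun measurableSet_Ioc fun s hs => hdrift i s hs.1.le
  have hii : ∀ i t, 0 ≤ t →
      (IntervalIntegrable (fun s => b (x s i) (empirical fun j => x s j)) volume 0 t ↔
        IntegrableOn (fun s => truncatedDrift b (x s) i) (Ioc 0 t)) := by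
    intro i t ht
    rw [intervalIntegrable_iff_integrableOn_Ioc_of_le ht]
    exact integrableOn_congr_fun (fun s hs => hdrift i s hs.1.le) measurableSet_Ioc
  constructor
  · intro hsol T hT
    have hi : ∀ t, 0 ≤ t → IntegrableOn (fun s => truncatedDrift b (x s)) (Ioc 0 t) := fun t ht =>
      Integrable.of_eval fun i => (hii i t ht).1 (hsol.integrable_drift i t ht)
    refine ⟨hi T hT, fun t ht => ?_⟩
    rw [jumpTerm_leftValue hfK h hx ht.2]
    funext i
    have h1 := hsol.equation i t ht.1
    rw [hint i t ht.1] at h1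
    rw [h1, Pi.add_apply, Pi.add_apply, eval_integral fun i => (hi t ht.1).eval i, jumpTerm_leftLims]
    ring
  · intro hsol
    refine ⟨hx, fun i t ht => (hii i t ht).2 ((hsol t ht).1.eval i), fun i t _ => ?_,
      fun i t _ => ?_, fun i t ht => ?_⟩
    · exact (h i).integrableOn (ownJumpAt_eq_zero hfK fun p => leftLims x p.1 i) t
    · exact (h i).integrableOn (collateralJumpAt_eq_zero hfK fun p => leftLims x p.1 i) t
    · have h1 := congrFun ((hsol t ht).2 t ⟨ht, le_rfl⟩) i
      rw [jumpTerm_leftValue hfK h hx le_rfl, Pi.add_apply, Pi.add_apply,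
        eval_integral fun i => (hsol t ht).1.eval i] at h1
      rw [hint i t ht, h1, jumpTerm_leftLims]
      ring

/-- The path that is constructed up to each time `t` from the noise up to time `t`. -/
def adaptedPath (α : ℝ) (f ψ : ℝ → ℝ) (K : ℝ) (B : (Fin N → ℝ) → Fin N → ℝ) (x₀ : Fin N → ℝ)
    (η : Fin N → Measure (ℝ × ℝ × ℝ)) (t : ℝ) : Fin N → ℝ :=
  pathLimit α f ψ B x₀ (fun i => cutNoise K t (η i)) t

lemma SolvesUpTo.mono {B : (Fin N → ℝ) → Fin N → ℝ} (hfK : ∀ x, f x ≤ K)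
    (h : ∀ i, IsLocallyFiniteNoise K (η i)) {x : ℝ → Fin N → ℝ} {t T : ℝ} (htT : t ≤ T)
    (hx : SolvesUpTo α f ψ B x₀ (fun i => cutNoise K T (η i)) T x) :
    SolvesUpTo α f ψ B x₀ (fun i => cutNoise K t (η i)) t x := by
  refine ⟨hx.1.mono_set (Ioc_subset_Ioc_right htT), fun s hs => ?_⟩
  have h1 := hx.2 s ⟨hs.1, hs.2.trans htT⟩
  rwa [jumpTerm_cutNoise hfK h _ (hs.2.trans htT), ← jumpTerm_cutNoise hfK h _ hs.2] at h1

variable {B : (Fin N → ℝ) → Fin N → ℝ} {L : ℝ≥0} {M : ℝ}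

lemma SolvesUpTo.eq_adaptedPath (hB : LipschitzWith L B) (hL : 1 ≤ L) (hM0 : 0 ≤ M)
    (hM : ∀ x, ‖B x‖ ≤ M) (hfK : ∀ x, f x ≤ K) (h : ∀ i, IsLocallyFiniteNoise K (η i))
    {x : ℝ → Fin N → ℝ} {T : ℝ}
    (hx : SolvesUpTo α f ψ B x₀ (fun i => cutNoise K T (η i)) T x) :
    ∀ t ∈ Icc 0 T, x t = adaptedPath α f ψ K B x₀ η t := by
  intro t ht
  choose n p hp hp0 using fun i => (h i).exists_atoms t
  exact (hx.mono hfK h ht.2).eq_pathLimit hB hL hM0 hM hp (fun i k => (hp0 i k).1) t ⟨ht.1, le_rfl⟩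

/-- The values at different times come from different cuts of the noise. By uniqueness they all lie,
up to time `T`, on the one regular path constructed from the noise up to `T`. -/
lemma solvesUpTo_adaptedPath (hB : LipschitzWith L B) (hL : 1 ≤ L) (hM0 : 0 ≤ M)
    (hM : ∀ x, ‖B x‖ ≤ M) (hfK : ∀ x, f x ≤ K) (h : ∀ i, IsLocallyFiniteNoise K (η i)) :
    (∀ i, IsCadlag fun t => adaptedPath α f ψ K B x₀ η t i) ∧ ∀ T,
      SolvesUpTo α f ψ B x₀ (fun i => cutNoise K T (η i)) T (adaptedPath α f ψ K B x₀ η) := by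
  have key : ∀ T, ∃ x : ℝ → Fin N → ℝ, (∀ i, IsRegular fun t => x t i) ∧
      (∀ t ∈ Icc 0 T, adaptedPath α f ψ K B x₀ η t = x t) ∧
      SolvesUpTo α f ψ B x₀ (fun i => cutNoise K T (η i)) T (adaptedPath α f ψ K B x₀ η) := by
    intro T
    choose n p hp hp0 using fun i => (h i).exists_atoms T
    obtain ⟨x, hxr, hx⟩ := exists_solvesUpTo (α := α) (f := f) (ψ := ψ) (x₀ := x₀) hB hL hM0 hM hp
      fun i k => (hp0 i k).1
    have heq := fun t ht => ((hx T).eq_adaptedPath hB hL hM0 hM hfK h t ht).symm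
    exact ⟨x, hxr, heq, (hx T).congr hp (fun i k => (hp0 i k).1) heq⟩
  refine ⟨fun i => ⟨fun t ht => ?_, fun t ht => ?_⟩, fun T => (key T).choose_spec.2.2⟩
  · obtain ⟨x, hxr, hx, -⟩ := key (t + 1)
    refine ((hxr i).right t).congr_of_eventuallyEq ?_ (by rw [hx t ⟨ht, by linarith⟩])
    filter_upwards [Icc_mem_nhdsGE (show t < t + 1 by linarith)] with s hs
    rw [hx s ⟨ht.trans hs.1, hs.2⟩]
  · obtain ⟨x, hxr, hx, -⟩ := key t
    obtain ⟨l, hl⟩ := (hxr i).left t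
    refine ⟨l, hl.congr' ?_⟩
    filter_upwards [Ioo_mem_nhdsLT ht] with s hs
    rw [hx s ⟨hs.1.le, hs.2.le⟩]

lemma IsCadlag.congr {g h : ℝ → ℝ} (hg : IsCadlag g) (hgh : ∀ t, 0 ≤ t → h t = g t) :
    IsCadlag h := by
  refine ⟨fun t ht => (hg.1 t ht).congr (fun s hs => hgh s (ht.trans hs)) (hgh t ht),
    fun t ht => ?_⟩
  obtain ⟨l, hl⟩ := hg.2 t ht
  refine ⟨l, hl.congr' ?_⟩
  filter_upwards [Ioo_mem_nhdsLT ht] with s hs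
  exact (hgh s hs.1.le).symm

/-- For one realisation of the noise, the particle system has a unique solution, and it is
nonnegative. -/
theorem isSolutionPath_adaptedPath (ha : IsDistanceFunction q a) (hb : DriftAssumption a b)
    (hN : 1 ≤ N) (hfK : ∀ x, f x ≤ K) (hψ : ∀ x, 0 ≤ ψ x)
    (h : ∀ i, IsLocallyFiniteNoise K (η i)) (hx₀ : ∀ i, 0 < x₀ i) :
    IsSolutionPath α b f ψ x₀ η
      (fun i t => max (adaptedPath α f ψ K (truncatedDrift b) x₀ η t i) 0) ∧
    ∀ Y : Fin N → ℝ → ℝ, IsSolutionPath α b f ψ x₀ η Y → ∀ i t, 0 ≤ t →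
      Y i t = max (adaptedPath α f ψ K (truncatedDrift b) x₀ η t i) 0 := by
  obtain ⟨L, hL1, hL⟩ := exists_lipschitz_truncatedDrift ha hb hN
  obtain ⟨M, hM0, hM⟩ := exists_bound_drift hb
  have hM' := norm_truncatedDrift_le hM0 hM hN
  obtain ⟨hcad, hsol⟩ := solvesUpTo_adaptedPath (α := α) (ψ := ψ) (x₀ := x₀) hL hL1 hM0 hM' hfK h
  set x := adaptedPath α f ψ K (truncatedDrift b) x₀ η with hx
  have hpos : ∀ i t, 0 ≤ t → 0 < x t i := by
    refine pos_of_equation ha hb hN hfK hψ h hx₀ hcad (α := α) (y := leftLims x)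
      (β := fun i s => truncatedDrift b (x s) i) (fun i t ht => ?_)
      (fun s hs i => truncatedDrift_of_nonneg hs i) fun i t ht => ?_
    · rw [intervalIntegrable_iff_integrableOn_Ioc_of_le ht]
      exact (hsol t).1.eval i
    · have h1 := congrFun ((hsol t).2 t ⟨ht, le_rfl⟩) i
      rw [jumpTerm_leftValue hfK h hcad le_rfl, Pi.add_apply, Pi.add_apply,
        eval_integral fun i => (hsol t).1.eval i] at h1
      rw [h1, intervalIntegral.integral_of_le ht]
      ring
  have hmax : ∀ i t, 0 ≤ t → max (x t i) 0 = x t i := fun i t ht => max_eq_left (hpos i t ht).le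
  constructor
  · refine (isSolutionPath_iff (x := fun t i => max (x t i) 0) hfK h
      (fun i => (hcad i).congr (hmax i)) fun i t _ => le_max_right _ _).2 fun T _ => ?_
    choose n p hp hp0 using fun i => (h i).exists_atoms T
    exact (hsol T).congr hp (fun i k => (hp0 i k).1) fun t ht => funext fun i => hmax i t ht.1
  · intro Y hY i t ht
    -- Since `b` is unconstrained at negative positions, `Y` must be shown positive before it can be
    -- compared with the truncated equation.
    have hYpos : ∀ i t, 0 ≤ t → 0 < Y i t := by
      refine pos_of_equation (x := fun t i => Y i t) ha hb hN hfK hψ h hx₀ hY.cadlag (α := α)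
        (y := leftLims fun t i => Y i t)
        (β := fun i s => b (Y i s) (empirical fun j => Y j s)) hY.integrable_drift
        (fun s hs i => rfl) fun i t ht => ?_
      rw [hY.equation i t ht, add_assoc]
      rfl
    have h1 := (isSolutionPath_iff (x := fun t i => Y i t) hfK h hY.cadlag
      fun i t ht => (hYpos i t ht).le).1 hY t ht
    rw [hmax i t ht, hx, ← h1.eq_adaptedPath hL hL1 hM0 hM' hfK h t ⟨ht, le_rfl⟩]

end Pathwise

/-! ### First moments of Poisson random measures. -/

section Poisson

lemma lintegral_poissonMeasure_natCast (r : ℝ≥0) :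
    ∫⁻ n, (n : ℝ≥0∞) ∂(poissonMeasure r) = r := by
  have h0 : ∀ g : ℕ → ℝ≥0∞, ∫⁻ n, g n ∂(poissonMeasure r) =
      ∑' n, ENNReal.ofReal (Real.exp (-r) * r ^ n / n.factorial) * g n := fun g => by
    simp [poissonMeasure, lintegral_sum_measure]
  rw [h0, tsum_eq_zero_add' ENNReal.summable, Nat.cast_zero, mul_zero, zero_add]
  have h1 : ∀ n : ℕ, ENNReal.ofReal (Real.exp (-r) * r ^ (n + 1) / (n + 1).factorial) *
      ((n + 1 : ℕ) : ℝ≥0∞) = ENNReal.ofReal (Real.exp (-r) * r ^ n / n.factorial) * r := by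
    intro n
    rw [← ENNReal.ofReal_natCast, ← ENNReal.ofReal_coe_nnreal, ← ENNReal.ofReal_mul (by positivity),
      ← ENNReal.ofReal_mul (by positivity)]
    congr 1
    rw [Nat.factorial_succ]
    push_cast
    have : (n.factorial : ℝ) ≠ 0 := by positivity
    have : (n : ℝ) + 1 ≠ 0 := by positivity
    field_simp
    ring
  simp only [h1]
  rw [← h0 fun _ => (r : ℝ≥0∞)]
  simp

variable {Ω E : Type*} [MeasurableSpace Ω] [MeasurableSpace E] {P : Measure Ω} {η : Ω → Measure E}
  {m : Measure E}

lemma IsPoissonRandomMeasure.lintegral_apply [IsProbabilityMeasure P]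
    (h : IsPoissonRandomMeasure P η m) {B : Set E} (hB : MeasurableSet B) :
    ∫⁻ ω, η ω B ∂P = m B := by
  by_cases hm : m B = ∞
  · rw [lintegral_congr_ae (h.law_top B hB hm), hm]
    simp
  · have h1 : Measurable fun ω => η ω B := (Measure.measurable_coe hB).comp h.measurable
    have h2 : ∫⁻ x, x ∂(P.map fun ω => η ω B) = ∫⁻ ω, η ω B ∂P :=
      lintegral_map measurable_id h1
    have h3 : ∫⁻ x, x ∂((poissonMeasure (m B).toNNReal).map fun n : ℕ => (n : ℝ≥0∞)) =
        ∫⁻ n : ℕ, (n : ℝ≥0∞) ∂(poissonMeasure (m B).toNNReal) :=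
      lintegral_map measurable_id (measurable_of_countable _)
    rw [← h2, h.law B hB hm, h3, lintegral_poissonMeasure_natCast, ENNReal.coe_toNNReal hm]

/-- Campbell's formula. -/
lemma IsPoissonRandomMeasure.lintegral_lintegral [IsProbabilityMeasure P]
    (h : IsPoissonRandomMeasure P η m) {g : E → ℝ≥0∞} (hg : Measurable g) :
    ∫⁻ ω, ∫⁻ x, g x ∂(η ω) ∂P = ∫⁻ x, g x ∂m := by
  -- The mean measure of `η` is its intensity, and integrals against a mixture are iterated
  -- integrals.
  have h1 : P.bind η = m := by
    ext B hB
    rw [Measure.bind_apply hB h.measurable.aemeasurable, h.lintegral_apply hB]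
  rw [← h1, Measure.lintegral_bind h.measurable.aemeasurable hg.aemeasurable]

variable {ν : Measure ℝ} [IsProbabilityMeasure ν]

lemma setLIntegral_intensity_le {g : ℝ → ℝ≥0∞} (hg : Measurable g) (K T : ℝ) :
    ∫⁻ p in jumpBox K T, g p.2.2 ∂(intensity ν) ≤
      ENNReal.ofReal T * (ENNReal.ofReal K * ∫⁻ u, g u ∂ν) := by
  rw [intensity, jumpBox, ← Measure.prod_restrict, ← Measure.prod_restrict,
    lintegral_prod _ (by fun_prop)]
  have h1 : ∀ s : ℝ, ∫⁻ y : ℝ × ℝ, g y.2 ∂(((volume.restrict (Ici (0 : ℝ))).restrict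
      (Icc 0 K)).prod (ν.restrict (Ici 0))) ≤ ENNReal.ofReal K * ∫⁻ u, g u ∂ν := by
    intro s
    rw [lintegral_prod _ (by fun_prop)]
    simp only [lintegral_const]
    rw [mul_comm]
    refine mul_le_mul' ?_ (setLIntegral_le_lintegral _ _)
    rw [Measure.restrict_apply_univ]
    exact (Measure.restrict_apply_le _ _).trans_eq (by simp)
  refine (lintegral_mono h1).trans ?_
  rw [lintegral_const, mul_comm]
  refine mul_le_mul' ?_ le_rfl
  rw [Measure.restrict_apply_univ]
  exact (Measure.restrict_apply_le _ _).trans_eq (by simp)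

lemma intensity_jumpBox_le (K T : ℝ) :
    intensity ν (jumpBox K T) ≤ ENNReal.ofReal T * ENNReal.ofReal K := by
  have h := setLIntegral_intensity_le (ν := ν) (g := fun _ => 1) measurable_const K T
  simpa using h

lemma intensity_Iic_zero : intensity ν (Iic 0 ×ˢ univ) = 0 := by
  rw [intensity, Measure.prod_prod, Measure.restrict_apply measurableSet_Iic,
    inter_comm, Ici_inter_Iic]
  simp

/-- Finite mean forces almost sure finiteness, and zero mean almost sure vanishing; integer horizons
suffice by monotonicity. -/
lemma IsPoissonRandomMeasure.ae_isLocallyFiniteNoise [IsProbabilityMeasure P]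
    {η : Ω → Measure (ℝ × ℝ × ℝ)} (h : IsPoissonRandomMeasure P η (intensity ν)) (K : ℝ) :
    ∀ᵐ ω ∂P, IsLocallyFiniteNoise K (η ω) := by
  have hmeas : ∀ B, MeasurableSet B → Measurable fun ω => η ω B := fun B hB =>
    (Measure.measurable_coe hB).comp h.measurable
  have h1 : ∀ᵐ ω ∂P, ∀ n : ℕ, η ω (jumpBox K n) < ∞ := by
    refine ae_all_iff.2 fun n => ae_lt_top (hmeas _ (measurableSet_jumpBox K n)) ?_
    rw [h.lintegral_apply (measurableSet_jumpBox K n)]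
    exact ((intensity_jumpBox_le K n).trans_lt (by finiteness)).ne
  have h2 : ∀ᵐ ω ∂P, η ω (Iic 0 ×ˢ univ) = 0 := by
    have hB : MeasurableSet (Iic (0 : ℝ) ×ˢ (univ : Set (ℝ × ℝ))) :=
      measurableSet_Iic.prod .univ
    refine (lintegral_eq_zero_iff (hmeas _ hB)).1 ?_
    rw [h.lintegral_apply hB, intensity_Iic_zero]
  filter_upwards [h1, h2, h.integer_valued] with ω h3 h4 h5
  refine ⟨fun T => ?_, h5, h4⟩
  obtain ⟨n, hn⟩ := exists_nat_ge T
  exact ((measure_mono (prod_mono (Icc_subset_Icc_right hn) subset_rfl)).trans_lt (h3 n)).ne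

end Poisson

/-! ### Subadditivity of `a`, and its integrals against the stable law. -/

section DistanceFunction

variable {q α : ℝ} {a : ℝ → ℝ}

lemma IsDistanceFunction.nonneg (ha : IsDistanceFunction q a) {x : ℝ} (hx : 0 ≤ x) : 0 ≤ a x :=
  ha.zero ▸ ha.strictMono.monotone hx

/-- Concavity and `a 0 = 0` put `a z` above the chord value `z / (x + y) * a (x + y)`; adding the
cases `z = x` and `z = y` gives the claim. -/
lemma IsDistanceFunction.add_le (ha : IsDistanceFunction q a) {x y : ℝ} (hx : 0 ≤ x)
    (hy : 0 ≤ y) : a (x + y) ≤ a x + a y := by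
  rcases (add_nonneg hx hy).eq_or_lt with h | h
  · have h1 : x = 0 := by linarith
    have h2 : y = 0 := by linarith
    simp [h1, h2, ha.zero]
  have key : ∀ z, 0 ≤ z → z ≤ x + y → z / (x + y) * a (x + y) ≤ a z := by
    intro z hz hzs
    have h1 := ha.concave.2 (mem_Ici.2 h.le) (mem_Ici.2 le_rfl) (div_nonneg hz h.le)
      (sub_nonneg.2 ((div_le_one h).2 hzs)) (add_sub_cancel _ _)
    simp only [ha.zero, smul_eq_mul, mul_zero, add_zero] at h1
    rwa [div_mul_cancel₀ _ h.ne'] at h1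
  have h1 := key x hx (by linarith)
  have h2 := key y hy (by linarith)
  have h3 : x / (x + y) * a (x + y) + y / (x + y) * a (x + y) = a (x + y) := by
    field_simp
  linarith

lemma IsDistanceFunction.sum_le (ha : IsDistanceFunction q a) {ι : Type*} (s : Finset ι)
    {x : ι → ℝ} (hx : ∀ i, 0 ≤ x i) : a (∑ i ∈ s, x i) ≤ ∑ i ∈ s, a (x i) :=
  Finset.le_sum_of_subadditive_on_pred a (fun y => 0 ≤ y) ha.zero.le
    (fun _ _ h h' => ha.add_le h h') (fun _ _ h h' => add_nonneg h h') x fun i _ => hx i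

lemma div_le_one_sub_exp_neg {y : ℝ} (hy : 0 ≤ y) : y / (1 + y) ≤ 1 - Real.exp (-y) := by
  have h1 := Real.add_one_le_exp y
  rw [Real.exp_neg]
  have h2 : (Real.exp y)⁻¹ ≤ (1 + y)⁻¹ := inv_anti₀ (by linarith) (by linarith)
  have h3 : y / (1 + y) = 1 - (1 + y)⁻¹ := by field_simp; ring
  linarith

/-- A function equivalent to `min x (x ^ q)`, in terms of exponentials. -/
lemma IsDistanceFunction.exists_le_tsum (ha : IsDistanceFunction q a) (hq : 0 < q) (hq1 : q < 1) :
    ∃ C : ℝ≥0, ∀ x, 0 ≤ x → ENNReal.ofReal (a x) ≤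
      C * ∑' k : ℕ, ENNReal.ofReal ((2 : ℝ) ^ (k * q) * (1 - Real.exp (-(x / 2 ^ k)))) := by
  obtain ⟨L, hL⟩ := ha.lipschitz
  obtain ⟨c, hc⟩ := ha.eq_rpow
  have hnn : (0 : ℝ) ≤ 2 * L + 4 * (|c| + 1) := by positivity
  refine ⟨⟨2 * L + 4 * (|c| + 1), hnn⟩, fun x hx => ?_⟩
  -- A single term suffices: `k = 0` for `x ≤ 1`, where `x / 2 ≤ 1 - exp (-x)`; otherwise the `k`
  -- with `2 ^ k ≤ x < 2 ^ (k + 1)`, where the exponential factor is at least `1 / 2` and `x ^ q ≤ 2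
  -- * 2 ^ (k q)`.
  have hterm : ∃ k : ℕ, a x ≤
      (2 * L + 4 * (|c| + 1)) * ((2 : ℝ) ^ (k * q) * (1 - Real.exp (-(x / 2 ^ k)))) := by
    rcases le_or_gt x 1 with h1 | h1
    · refine ⟨0, ?_⟩
      have h2 := div_le_one_sub_exp_neg hx
      have h3 : x / 2 ≤ x / (1 + x) := div_le_div_of_nonneg_left hx (by linarith) (by linarith)
      have h4 := hL.dist_le_mul x 0
      rw [Real.dist_eq, Real.dist_eq, ha.zero, sub_zero, sub_zero, abs_of_nonneg hx,
        abs_of_nonneg (ha.nonneg hx)] at h4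
      simp only [Nat.cast_zero, zero_mul, Real.rpow_zero, pow_zero, div_one, one_mul]
      have h5 : (0 : ℝ) ≤ L := L.2
      have h6 := abs_nonneg c
      calc a x ≤ L * x := h4
        _ = 2 * L * (x / 2) := by ring
        _ ≤ (2 * L + 4 * (|c| + 1)) * (x / 2) := by gcongr; linarith
        _ ≤ _ := by gcongr; linarith
    · obtain ⟨k, hk1, hk2⟩ := exists_nat_pow_near h1.le (by norm_num : (1 : ℝ) < 2)
      refine ⟨k, ?_⟩
      have h2 : 1 ≤ x / 2 ^ k := (one_le_div (by positivity)).2 hk1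
      have h3 := div_le_one_sub_exp_neg (zero_le_one.trans h2)
      have h4 : 1 / 2 ≤ x / 2 ^ k / (1 + x / 2 ^ k) := by
        rw [div_le_div_iff₀ (by norm_num) (by linarith)]; linarith
      have h5 : x ^ q ≤ 2 * (2 : ℝ) ^ (k * q) := by
        calc x ^ q ≤ ((2 : ℝ) ^ (k + 1)) ^ q := by gcongr
          _ = (2 : ℝ) ^ q * (2 : ℝ) ^ (k * q) := by
            rw [← Real.rpow_natCast, ← Real.rpow_mul (by norm_num), ← Real.rpow_add (by norm_num)]
            congr 1; push_cast; ring
          _ ≤ (2 : ℝ) ^ (1 : ℝ) * (2 : ℝ) ^ (k * q) := by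
            gcongr
            norm_num
          _ = _ := by rw [Real.rpow_one]
      have h6 : 1 ≤ x ^ q := Real.one_le_rpow h1.le hq.le
      have h7 := abs_nonneg c
      have h8 := le_abs_self c
      have h9 : (0 : ℝ) ≤ L := L.2
      rw [hc x h1.le]
      calc c + x ^ q ≤ (|c| + 1) * x ^ q := by nlinarith
        _ ≤ (|c| + 1) * (2 * (2 : ℝ) ^ (k * q)) := by gcongr
        _ = 4 * (|c| + 1) * ((2 : ℝ) ^ (k * q) * (1 / 2)) := by ring
        _ ≤ (2 * L + 4 * (|c| + 1)) * ((2 : ℝ) ^ (k * q) * (1 / 2)) := by gcongr; linarith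
        _ ≤ _ := by gcongr; linarith
  obtain ⟨k, hk⟩ := hterm
  refine (ENNReal.ofReal_le_ofReal hk).trans ?_
  rw [ENNReal.ofReal_mul hnn, ENNReal.ofReal_eq_coe_nnreal hnn]
  exact mul_le_mul' le_rfl (ENNReal.le_tsum k)

variable {ν : Measure ℝ}

lemma IsPositiveStableLaw.ae_nonneg (hν : IsPositiveStableLaw α ν) : ∀ᵐ u ∂ν, 0 ≤ u := by
  rw [ae_iff]
  convert hν.nonneg using 2
  ext x
  simp

/-- The integral is `1 - exp (-r ^ α)`, and `1 - exp (-y) ≤ y`. -/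
lemma IsPositiveStableLaw.lintegral_one_sub_exp_le (hν : IsPositiveStableLaw α ν) {r : ℝ}
    (hr : 0 ≤ r) : ∫⁻ u, ENNReal.ofReal (1 - Real.exp (-(r * u))) ∂ν ≤ ENNReal.ofReal (r ^ α) := by
  have := hν.isProbabilityMeasure
  have h1 : ∀ᵐ u ∂ν, Real.exp (-(r * u)) ≤ 1 := by
    filter_upwards [hν.ae_nonneg] with u hu
    rw [Real.exp_le_one_iff]
    nlinarith
  have h2 : Integrable (fun u => Real.exp (-(r * u))) ν := by
    refine Integrable.of_bound (C := 1) (by fun_prop) ?_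
    filter_upwards [h1] with u hu
    rwa [Real.norm_eq_abs, Real.abs_exp]
  have h4 : Integrable (fun u => 1 - Real.exp (-(r * u))) ν := (integrable_const 1).sub h2
  rw [← ofReal_integral_eq_lintegral_ofReal h4
    (by filter_upwards [h1] with u hu using sub_nonneg.2 hu)]
  refine ENNReal.ofReal_le_ofReal ?_
  rw [integral_sub (integrable_const 1) h2]
  have h3 := hν.laplace r hr
  simp only [neg_mul] at h3
  rw [h3, integral_const, probReal_univ, one_smul]
  have := Real.add_one_le_exp (-(r ^ α))
  linarith

/-- The truncated moments of a stable law: `E a (ε U) ≤ C ε ^ α`. -/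
lemma exists_lintegral_le (ha : IsDistanceFunction q a) (hν : IsPositiveStableLaw α ν)
    (hq : 0 < q) (hqα : q < α) (hα : α < 1) :
    ∃ C : ℝ≥0, ∀ ε : ℝ, 0 ≤ ε →
      ∫⁻ u, ENNReal.ofReal (a (ε * u)) ∂ν ≤ C * ENNReal.ofReal (ε ^ α) := by
  obtain ⟨C, hC⟩ := ha.exists_le_tsum hq (hqα.trans hα)
  have hr : (2 : ℝ) ^ (q - α) < 1 :=
    Real.rpow_lt_one_of_one_lt_of_neg (by norm_num) (by linarith)
  have hr' : ENNReal.ofReal ((2 : ℝ) ^ (q - α)) < 1 := ENNReal.ofReal_lt_one.2 hr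
  set S : ℝ≥0∞ := ∑' k : ℕ, ENNReal.ofReal ((2 : ℝ) ^ (q - α)) ^ k with hS
  have hSt : S ≠ ∞ := by
    rw [hS, ENNReal.tsum_geometric]
    exact ENNReal.inv_ne_top.2 (tsub_pos_of_lt hr').ne'
  refine ⟨C * S.toNNReal, fun ε hε => ?_⟩
  -- The Laplace transform at `r = ε / 2 ^ k` turns the `k`-th term into `2 ^ (k (q - α)) * ε ^ α`;
  -- the series is geometric, convergent because `q < α`.
  have hterm : ∀ k : ℕ, ∫⁻ u, ENNReal.ofReal ((2 : ℝ) ^ (k * q) *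
      (1 - Real.exp (-(ε * u / 2 ^ k)))) ∂ν ≤
      ENNReal.ofReal ((2 : ℝ) ^ (q - α)) ^ k * ENNReal.ofReal (ε ^ α) := by
    intro k
    have h1 : ∀ u, ENNReal.ofReal ((2 : ℝ) ^ (k * q) * (1 - Real.exp (-(ε * u / 2 ^ k)))) =
        ENNReal.ofReal ((2 : ℝ) ^ (k * q)) *
          ENNReal.ofReal (1 - Real.exp (-(ε / 2 ^ k * u))) := fun u => by
      rw [ENNReal.ofReal_mul (by positivity), div_mul_eq_mul_div]
    simp only [h1]
    rw [lintegral_const_mul _ (by fun_prop)]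
    refine (mul_le_mul' le_rfl (hν.lintegral_one_sub_exp_le (by positivity))).trans_eq ?_
    rw [← ENNReal.ofReal_mul (by positivity), ← ENNReal.ofReal_pow (by positivity),
      ← ENNReal.ofReal_mul (by positivity)]
    congr 1
    rw [Real.div_rpow hε (by positivity), ← Real.rpow_natCast 2 k,
      ← Real.rpow_natCast ((2 : ℝ) ^ (q - α)) k, ← Real.rpow_mul (by norm_num),
      ← Real.rpow_mul (by norm_num), sub_mul, Real.rpow_sub (by norm_num), mul_comm q, mul_comm α]
    ring
  calc ∫⁻ u, ENNReal.ofReal (a (ε * u)) ∂ν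
      ≤ ∫⁻ u, C * ∑' k : ℕ, ENNReal.ofReal ((2 : ℝ) ^ (k * q) *
          (1 - Real.exp (-(ε * u / 2 ^ k)))) ∂ν := by
        refine lintegral_mono_ae ?_
        filter_upwards [hν.ae_nonneg] with u hu using hC _ (mul_nonneg hε hu)
    _ = C * ∑' k : ℕ, ∫⁻ u, ENNReal.ofReal ((2 : ℝ) ^ (k * q) *
          (1 - Real.exp (-(ε * u / 2 ^ k)))) ∂ν := by
        rw [lintegral_const_mul _ (Measurable.tsum fun k => by fun_prop),
          lintegral_tsum fun k => by fun_prop]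
    _ ≤ C * ∑' k : ℕ, ENNReal.ofReal ((2 : ℝ) ^ (q - α)) ^ k * ENNReal.ofReal (ε ^ α) := by
        gcongr with k
        exact hterm k
    _ = ↑(C * S.toNNReal) * ENNReal.ofReal (ε ^ α) := by
        rw [ENNReal.tsum_mul_right, ← hS, ENNReal.coe_mul, ENNReal.coe_toNNReal hSt, mul_assoc]

end DistanceFunction

/-! ### Pathwise bound of the particles by the noise. -/

section Moments

variable {K : ℝ}

lemma IsLocallyFiniteNoise.integrableOn_jumpBox {η : Measure (ℝ × ℝ × ℝ)}
    (h : IsLocallyFiniteNoise K η) (g : ℝ × ℝ × ℝ → ℝ) (T : ℝ) :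
    IntegrableOn g (jumpBox K T) η := by
  rw [IntegrableOn, ← h.cutNoise_eq T]
  obtain ⟨n, p, hp, -⟩ := h.exists_atoms T
  rw [hp]
  exact integrable_sum_dirac p g

lemma IsLocallyFiniteNoise.setIntegral_le {η : Measure (ℝ × ℝ × ℝ)}
    (h : IsLocallyFiniteNoise K η) {g G : ℝ × ℝ × ℝ → ℝ} (hg : ∀ p, K < p.2.1 → g p = 0) {t T : ℝ}
    (htT : t ≤ T) (hg0 : ∀ p ∈ jumpDomain T, 0 ≤ g p) (hgG : ∀ p ∈ jumpBox K T, g p ≤ G p) :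
    ∫ p in jumpDomain t, g p ∂η ≤ ∫ p in jumpBox K T, G p ∂η := by
  have hsub : jumpDomain t ⊆ jumpDomain T := prod_mono (Icc_subset_Icc_right htT) subset_rfl
  refine (setIntegral_mono_set (h.integrableOn hg T) ?_ hsub.eventuallyLE).trans ?_
  · filter_upwards [ae_restrict_mem (measurableSet_jumpDomain T)] with p hp using hg0 p hp
  · rw [setIntegral_eq_jumpBox hg]
    exact setIntegral_mono_on (h.integrableOn_jumpBox _ T) (h.integrableOn_jumpBox _ T)
      (measurableSet_jumpBox K T) hgG

variable {q α : ℝ} {a : ℝ → ℝ}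

/-- Subadditivity of `a` along the atoms of the noise. -/
lemma IsLocallyFiniteNoise.ofReal_le_lintegral {η : Measure (ℝ × ℝ × ℝ)}
    (h : IsLocallyFiniteNoise K η) (ha : IsDistanceFunction q a) {c : ℝ} (hc : 0 ≤ c) (T : ℝ) :
    ENNReal.ofReal (a (c * ∫ p in jumpBox K T, p.2.2 ∂η)) ≤
      ∫⁻ p in jumpBox K T, ENNReal.ofReal (a (c * p.2.2)) ∂η := by
  rw [← h.cutNoise_eq T]
  obtain ⟨n, p, hp, hp0⟩ := h.exists_atoms T
  have h0 : ∀ k, 0 ≤ c * (p k).2.2 := fun k => mul_nonneg hc (hp0 k).2.2.2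
  rw [hp, integral_sum_dirac', lintegral_finsetSum_measure, Finset.mul_sum]
  simp only [lintegral_dirac]
  rw [← ENNReal.ofReal_sum_of_nonneg fun k _ => ha.nonneg (h0 k)]
  exact ENNReal.ofReal_le_ofReal (ha.sum_le _ h0)

variable {N : ℕ} {f ψ : ℝ → ℝ} {b : ℝ → Measure ℝ → ℝ} {x₀ : Fin N → ℝ}
  {η : Fin N → Measure (ℝ × ℝ × ℝ)}

/-- Nonnegative solutions are controlled by the noise. -/
lemma IsSolutionPath.ofReal_abs_le (ha : IsDistanceFunction q a) {L : ℝ≥0} (hL : LipschitzWith L a)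
    {M : ℝ} (hM0 : 0 ≤ M) (hM : ∀ x : ℝ, 0 ≤ x → ∀ μ ∈ P1, |b x μ| ≤ M) (hN : 1 ≤ N)
    (hfK : ∀ x, f x ≤ K) {R : ℝ} (hψ : ∀ x, 0 ≤ ψ x) (hψR : ∀ x, ψ x ≤ R)
    (h : ∀ i, IsLocallyFiniteNoise K (η i)) (hx₀ : ∀ i, 0 < x₀ i) {x : Fin N → ℝ → ℝ}
    (hx : IsSolutionPath α b f ψ x₀ η x) (hx0 : ∀ i t, 0 ≤ t → 0 ≤ x i t) (i : Fin N) {t T : ℝ}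
    (ht : t ∈ Icc 0 T) :
    ENNReal.ofReal |a (x i t)| ≤ ENNReal.ofReal (a (x₀ i)) + ENNReal.ofReal (a (M * T)) +
      ENNReal.ofReal (L * R) * η i (jumpBox K T) +
      ∑ j, ∫⁻ p in jumpBox K T, ENNReal.ofReal (a (1 / (N : ℝ) ^ (1 / α) * p.2.2)) ∂(η j) := by
  have hT : 0 ≤ T := ht.1.trans ht.2
  have hR : 0 ≤ R := (hψ 0).trans (hψR 0)
  set c : ℝ := 1 / (N : ℝ) ^ (1 / α) with hc
  have hc0 : 0 ≤ c := by positivity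
  have hdrift : ∫ s in (0 : ℝ)..t, b (x i s) (empirical fun j => x j s) ≤ M * T := by
    have h1 := intervalIntegral.norm_integral_le_of_norm_le_const (a := 0) (b := t) (C := M)
      (f := fun s => b (x i s) (empirical fun j => x j s)) fun s hs => by
        rw [uIoc_of_le ht.1] at hs
        exact hM _ (hx0 i s hs.1.le) _ (empirical_mem_P1 hN fun j => hx0 j s hs.1.le)
    rw [sub_zero, abs_of_nonneg ht.1] at h1
    exact (le_abs_self _).trans (h1.trans (by gcongr; exact ht.2))
  have hown : ∫ p in jumpDomain t, ownJump f ψ (x i) p ∂(η i) ≤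
      R * (η i (jumpBox K T)).toReal := by
    refine ((h i).setIntegral_le (G := fun _ => R)
      (ownJumpAt_eq_zero hfK fun p => Function.leftLim (x i) p.1) ht.2 (fun p _ => ?_)
      fun p _ => ?_).trans_eq ?_
    · simp only [ownJumpAt]
      split_ifs
      exacts [hψ _, le_rfl]
    · simp only [ownJumpAt]
      split_ifs
      exacts [hψR _, hR]
    · rw [setIntegral_const, smul_eq_mul, mul_comm]
      rfl
  have hcoll : ∀ j, ∫ p in jumpDomain t, collateralJump f (x j) p ∂(η j) ≤
      ∫ p in jumpBox K T, p.2.2 ∂(η j) := by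
    intro j
    refine (h j).setIntegral_le
      (collateralJumpAt_eq_zero hfK fun p => Function.leftLim (x j) p.1) ht.2 (fun p hp => ?_)
      fun p hp => ?_
    · simp only [collateralJumpAt]
      split_ifs
      exacts [hp.2.2, le_rfl]
    · simp only [collateralJumpAt]
      split_ifs
      exacts [le_rfl, hp.2.2]
  set U : Fin N → ℝ := fun j => ∫ p in jumpBox K T, p.2.2 ∂(η j) with hU
  have hU0 : ∀ j, 0 ≤ U j := fun j =>
    setIntegral_nonneg (measurableSet_jumpBox K T) fun p hp => hp.2.2
  -- The missing term `j = i` is nonnegative and may be added.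
  have hsum : c * ∑ j ∈ Finset.univ.erase i, ∫ p in jumpDomain t, collateralJump f (x j) p ∂(η j) ≤
      ∑ j, c * U j := by
    rw [← Finset.mul_sum]
    gcongr
    exact (Finset.sum_le_sum fun j _ => hcoll j).trans
      (Finset.sum_le_sum_of_subset_of_nonneg (Finset.erase_subset _ _) fun j _ _ => hU0 j)
  set n : ℝ := (η i (jumpBox K T)).toReal with hn
  have hn0 : 0 ≤ n := ENNReal.toReal_nonneg
  have hcU : ∀ j, 0 ≤ c * U j := fun j => mul_nonneg hc0 (hU0 j)
  have hx1 : x i t ≤ x₀ i + M * T + R * n + ∑ j, c * U j := by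
    rw [hx.equation i t ht.1]
    exact add_le_add (add_le_add (add_le_add le_rfl hdrift) hown) hsum
  have hMT : 0 ≤ M * T := mul_nonneg hM0 hT
  have hRn : 0 ≤ R * n := mul_nonneg hR hn0
  have hlast : a (R * n) ≤ L * R * n := by
    have h1 := hL.dist_le_mul (R * n) 0
    rw [Real.dist_eq, Real.dist_eq, ha.zero, sub_zero, sub_zero, abs_of_nonneg hRn,
      abs_of_nonneg (ha.nonneg hRn)] at h1
    linarith
  -- Subadditivity separates the contributions. The own jumps are only counted, since each is at
  -- most `R` and `a` is Lipschitz.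
  have hreal : a (x i t) ≤ a (x₀ i) + a (M * T) + L * R * n + ∑ j, a (c * U j) := by
    calc a (x i t) ≤ a (x₀ i + M * T + R * n + ∑ j, c * U j) := ha.strictMono.monotone hx1
      _ ≤ a (x₀ i + M * T + R * n) + a (∑ j, c * U j) :=
        ha.add_le (by linarith [hx₀ i]) (Finset.sum_nonneg fun j _ => hcU j)
      _ ≤ (a (x₀ i + M * T) + a (R * n)) + ∑ j, a (c * U j) :=
        add_le_add (ha.add_le (by linarith [hx₀ i]) hRn) (ha.sum_le _ hcU)
      _ ≤ _ := by
        have := ha.add_le (hx₀ i).le hMT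
        linarith
  rw [abs_of_nonneg (ha.nonneg (hx0 i t ht.1))]
  refine (ENNReal.ofReal_le_ofReal hreal).trans (ENNReal.ofReal_add_le.trans ?_)
  refine add_le_add (ENNReal.ofReal_add_le.trans (add_le_add ENNReal.ofReal_add_le ?_)) ?_
  · rw [ENNReal.ofReal_mul (by positivity), hn, ENNReal.ofReal_toReal ((h i).finite T)]
  · rw [ENNReal.ofReal_sum_of_nonneg fun j _ => ha.nonneg (hcU j)]
    exact Finset.sum_le_sum fun j _ => (h j).ofReal_le_lintegral ha hc0 T

end Moments

/-! ### Expectation of the pathwise bound, uniformly in the number of particles. -/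

section Expectation

variable {Ω : Type*} [MeasurableSpace Ω] {P : Measure Ω} [IsProbabilityMeasure P]
  {α q : ℝ} {a : ℝ → ℝ} {b : ℝ → Measure ℝ → ℝ} {f ψ : ℝ → ℝ} {ν ν₀ : Measure ℝ}
  {π : ℕ → Ω → Measure (ℝ × ℝ × ℝ)} {X₀ : ℕ → Ω → ℝ}

omit [IsProbabilityMeasure P] in
lemma IsDrivingNoise.ae_pos (h : IsDrivingNoise P ν ν₀ π X₀) (hf : JumpAssumption α a f ψ ν₀) :
    ∀ᵐ ω ∂P, ∀ i, 0 < X₀ i ω := by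
  refine ae_all_iff.2 fun i => ?_
  have h1 : ∀ᵐ x ∂ν₀, 0 < x := by
    rw [ae_iff]
    have h2 : {x : ℝ | ¬ 0 < x} = Iio 0 ∪ {0} := by
      ext x
      simp [le_iff_lt_or_eq]
    rw [h2]
    exact measure_union_null hf.init_nonneg hf.init_zero
  rw [← h.init_law i] at h1
  exact ae_of_ae_map (h.init_measurable i).aemeasurable h1

/-- Here `a x ≤ L |x|`, and `|x| ≤ 1 + |x| ^ max (2 * α) 1` as the exponent is at least `1`. -/
lemma lintegral_init_lt_top (ha : IsDistanceFunction q a) (hf : JumpAssumption α a f ψ ν₀) :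
    ∫⁻ x, ENNReal.ofReal (a x) ∂ν₀ < ∞ := by
  obtain ⟨L, hL⟩ := ha.lipschitz
  have := hf.init_isProbabilityMeasure
  have h1 : Integrable (fun x : ℝ => L * (1 + |x| ^ max (2 * α) 1)) ν₀ :=
    ((integrable_const 1).add hf.init_moment).const_mul _
  refine (lintegral_mono fun x => ENNReal.ofReal_le_ofReal ?_).trans_lt h1.lintegral_lt_top
  have h2 := hL.dist_le_mul x 0
  rw [Real.dist_eq, Real.dist_eq, ha.zero, sub_zero, sub_zero] at h2
  refine (le_abs_self _).trans (h2.trans (mul_le_mul_of_nonneg_left ?_ L.2))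
  rcases le_or_gt |x| 1 with h | h
  · have : 0 ≤ |x| ^ max (2 * α) 1 := by positivity
    linarith
  · have := Real.rpow_le_rpow_of_exponent_le h.le (le_max_right (2 * α) 1)
    rw [Real.rpow_one] at this
    linarith

/-- The expectation of the bound in `IsSolutionPath.ofReal_abs_le`. -/
lemma lintegral_bound_le (ha : IsDistanceFunction q a) (hν : IsPositiveStableLaw α ν)
    (hα : 0 < α) {C : ℝ≥0} (hC : ∀ ε : ℝ, 0 ≤ ε →
      ∫⁻ u, ENNReal.ofReal (a (ε * u)) ∂ν ≤ C * ENNReal.ofReal (ε ^ α))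
    (h : IsDrivingNoise P ν ν₀ π X₀) {N : ℕ} (hN : 1 ≤ N) (i : Fin N) (A B K T : ℝ) :
    ∫⁻ ω, (ENNReal.ofReal (a (X₀ i ω)) + ENNReal.ofReal A +
      ENNReal.ofReal B * π i ω (jumpBox K T) +
      ∑ j : Fin N, ∫⁻ p in jumpBox K T,
        ENNReal.ofReal (a (1 / (N : ℝ) ^ (1 / α) * p.2.2)) ∂(π j ω)) ∂P ≤
    ∫⁻ x, ENNReal.ofReal (a x) ∂ν₀ + ENNReal.ofReal A +
      ENNReal.ofReal B * (ENNReal.ofReal T * ENNReal.ofReal K) +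
      ENNReal.ofReal T * (ENNReal.ofReal K * C) := by
  have := hν.isProbabilityMeasure
  have ham : Measurable a := ha.strictMono.monotone.measurable
  set g : ℝ → ℝ≥0∞ := fun u => ENNReal.ofReal (a (1 / (N : ℝ) ^ (1 / α) * u)) with hg
  have hgm : Measurable g := by fun_prop
  have hG : Measurable fun p : ℝ × ℝ × ℝ => (jumpBox K T).indicator (fun p => g p.2.2) p :=
    Measurable.indicator (by fun_prop) (measurableSet_jumpBox K T)
  have hset : ∀ μ : Measure (ℝ × ℝ × ℝ), ∫⁻ p in jumpBox K T, g p.2.2 ∂μ =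
      ∫⁻ p, (jumpBox K T).indicator (fun p => g p.2.2) p ∂μ := fun μ =>
    (lintegral_indicator (measurableSet_jumpBox K T) _).symm
  have hm3 : ∀ j, Measurable fun ω => ∫⁻ p in jumpBox K T, g p.2.2 ∂(π j ω) := by
    intro j
    simp only [hset]
    exact (Measure.measurable_lintegral hG).comp (h.poisson j).measurable
  have hm2 : Measurable fun ω => π i ω (jumpBox K T) :=
    (Measure.measurable_coe (measurableSet_jumpBox K T)).comp (h.poisson i).measurable
  have hm1 : Measurable fun ω => ENNReal.ofReal (a (X₀ i ω)) :=
    (ham.comp (h.init_measurable i)).ennreal_ofReal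
  change ∫⁻ ω, (ENNReal.ofReal (a (X₀ i ω)) + ENNReal.ofReal A +
    ENNReal.ofReal B * π i ω (jumpBox K T) +
      ∑ j : Fin N, ∫⁻ p in jumpBox K T, g p.2.2 ∂(π j ω)) ∂P ≤ _
  rw [lintegral_add_left (by fun_prop), lintegral_add_left (by fun_prop), lintegral_add_left hm1,
    lintegral_finsetSum _ fun (j : Fin N) _ => hm3 j, lintegral_const_mul _ hm2, lintegral_const,
    measure_univ, mul_one]
  have h1 : ∫⁻ ω, ENNReal.ofReal (a (X₀ i ω)) ∂P = ∫⁻ x, ENNReal.ofReal (a x) ∂ν₀ := by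
    rw [← h.init_law i, lintegral_map (by fun_prop) (h.init_measurable i)]
  have h2 : ∫⁻ ω, π i ω (jumpBox K T) ∂P ≤ ENNReal.ofReal T * ENNReal.ofReal K := by
    rw [(h.poisson i).lintegral_apply (measurableSet_jumpBox K T)]
    exact intensity_jumpBox_le K T
  have hN0 : (0 : ℝ) < N := by exact_mod_cast hN
  -- The choice `ε = N ^ (-1/α)` makes `ε ^ α = 1 / N`, which the sum over the `N` particles cancels
  -- exactly.
  have h3 : ∀ j : Fin N, ∫⁻ ω, ∫⁻ p in jumpBox K T, g p.2.2 ∂(π j ω) ∂P ≤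
      ENNReal.ofReal T * (ENNReal.ofReal K * (C * ENNReal.ofReal (1 / N))) := by
    intro j
    simp only [hset]
    rw [(h.poisson j).lintegral_lintegral hG, ← hset]
    refine (setLIntegral_intensity_le hgm K T).trans ?_
    gcongr
    refine (hC _ (by positivity)).trans_eq ?_
    rw [Real.div_rpow zero_le_one (by positivity), Real.one_rpow, ← Real.rpow_mul hN0.le,
      one_div_mul_cancel hα.ne', Real.rpow_one]
  rw [h1]
  gcongr
  refine (Finset.sum_le_sum fun j _ => h3 j).trans_eq ?_
  rw [Finset.sum_const, Finset.card_univ, Fintype.card_fin, nsmul_eq_mul]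
  have h4 : (N : ℝ≥0∞) * ENNReal.ofReal (1 / N) = 1 := by
    rw [← ENNReal.ofReal_natCast, ← ENNReal.ofReal_mul hN0.le, mul_one_div_cancel hN0.ne',
      ENNReal.ofReal_one]
  calc (N : ℝ≥0∞) * (ENNReal.ofReal T * (ENNReal.ofReal K * (C * ENNReal.ofReal (1 / N))))
      = ENNReal.ofReal T * (ENNReal.ofReal K * C) * (N * ENNReal.ofReal (1 / N)) := by ring
    _ = _ := by rw [h4, mul_one]

end Expectation

end StableParticles

end

/-! ### The theorem. -/

open StableParticles in
theorem proposition3p7 {Ω : Type*} [MeasurableSpace Ω] (P : Measure Ω) [IsProbabilityMeasure P]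
    (α q : ℝ) (hα : α ∈ Ioo (0 : ℝ) 1) (hq : q ∈ Ioo 0 α)
    (a : ℝ → ℝ) (ha : IsDistanceFunction q a)
    (b : ℝ → Measure ℝ → ℝ) (hb : DriftAssumption a b)
    (f ψ : ℝ → ℝ) (ν₀ : Measure ℝ) (hf : JumpAssumption α a f ψ ν₀)
    (ν : Measure ℝ) (hν : IsPositiveStableLaw α ν)
    (π : ℕ → Ω → Measure (ℝ × ℝ × ℝ)) (X₀ : ℕ → Ω → ℝ) (hπ : IsDrivingNoise P ν ν₀ π X₀) :
    ∃ C : ℝ → ℝ≥0, ∀ N : ℕ, 1 ≤ N → ∃ X : Fin N → ℝ → Ω → ℝ,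
      IsStrongSolution P α b f ψ π X₀ X ∧
      (∀ i t ω, 0 ≤ t → 0 ≤ X i t ω) ∧
      (∀ Y : Fin N → ℝ → Ω → ℝ, IsSolution P α b f ψ π X₀ Y →
        ∀ᵐ ω ∂P, ∀ i t, 0 ≤ t → Y i t ω = X i t ω) ∧
      ∀ T : ℝ, 0 < T → ∀ i, ∫⁻ ω, ⨆ t ∈ Icc 0 T, ENNReal.ofReal |a (X i t ω)| ∂P ≤ C T := by
  have := hν.isProbabilityMeasure
  obtain ⟨K, hfK⟩ := hf.f_bounded
  obtain ⟨Lf, hLf⟩ := hf.f_lipschitz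
  obtain ⟨R, hψR⟩ := hf.psi_bounded
  obtain ⟨Lψ, hLψ⟩ := hf.psi_lipschitz
  obtain ⟨L, hL⟩ := ha.lipschitz
  obtain ⟨M, hM0, hM⟩ := exists_bound_drift hb
  obtain ⟨C, hC⟩ := exists_lintegral_le ha hν hq.1 hq.2 hα.2
  have hgood : ∀ᵐ ω ∂P, ∀ i, IsLocallyFiniteNoise K (π i ω) :=
    ae_all_iff.2 fun i => (hπ.poisson i).ae_isLocallyFiniteNoise K
  have hpos := hπ.ae_pos hf
  -- The summands bound, in order, the initial value, the drift, the own jumps and the collateral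
  -- jumps.
  refine ⟨fun T => (∫⁻ x, ENNReal.ofReal (a x) ∂ν₀).toNNReal + (a (M * T)).toNNReal +
    (L * R).toNNReal * (T.toNNReal * K.toNNReal) + T.toNNReal * (K.toNNReal * C), fun N hN => ?_⟩
  have hsol : IsSolution P α b f ψ π X₀ (particles α b f ψ K π X₀ N) := by
    filter_upwards [hgood, hpos] with ω h1 h2
    exact (isSolutionPath_adaptedPath ha hb hN hfK hf.psi_nonneg (fun i => h1 i) fun i => h2 i).1
  refine ⟨particles α b f ψ K π X₀ N, ⟨hsol, fun i t ht => ?_⟩,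
    fun i t ω _ => le_max_right _ _, fun Y hY => ?_, fun T _ i => ?_⟩
  · exact measurable_particles ha hb hLf.continuous.measurable hLψ.continuous.measurable K π X₀ hN
      i ht
  · filter_upwards [hgood, hpos, hY] with ω h1 h2 h3
    exact (isSolutionPath_adaptedPath ha hb hN hfK hf.psi_nonneg (fun i => h1 i)
      fun i => h2 i).2 _ h3
  · refine (lintegral_mono_ae ?_).trans ((lintegral_bound_le ha hν hα.1 hC hπ hN i
      (a (M * T)) (L * R) K T).trans_eq ?_)
    · filter_upwards [hgood, hpos, hsol] with ω h1 h2 h3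
      -- The pathwise bound does not depend on `t`, so it bounds the supremum, whose measurability
      -- is not needed.
      exact iSup₂_le fun t ht => h3.ofReal_abs_le ha hL hM0 hM hN hfK hf.psi_nonneg hψR
        (fun i => h1 i) (fun i => h2 i) (fun i t _ => le_max_right _ _) i ht
    -- `ENNReal.ofReal x` is by definition the coercion of `x.toNNReal`.
    · push_cast
      rw [ENNReal.coe_toNNReal (lintegral_init_lt_top ha hf).ne]
      rfl
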